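/- **Setup.** Let $\mathcal P_\Theta=\{P_\theta:\theta\in\Theta\}$, $\Theta\subseteq\mathbb R^d$, be a model with densities $p_\theta$ with respect to a $\sigma$-finite measure $\mu$. Let $\mathcal G$ be a class of probability measures. For each $G\in\mathcal G$ let $\theta_G\in\Theta$ minimize $\theta\mapsto \mathrm{KL}(G\|P_\theta)$ over $\Theta$, with $p_{\theta_G}>0$ $G$-a.s. Let $\alpha\in(0,1)$. For each $n\ge 1$ an i.i.d. sample from $G$ is split into independent subsamples $D_1$ and $D_2$ with $|D_2|=n$. The initial estimator $\widehat\theta_1\in\Theta$ is any measurable function of $D_1$, and $$\mathrm{CI}_{n,\alpha}=\Big\{\theta\in\Theta:\ \sum_{i\in D_2}\log\frac{p_{\widehat\theta_1}(Z_i)}{p_\theta(Z_i)}\le\log(1/\alpha)\Big\}.$$ Write $\|x\|_A^2=x^\top A x$, let $\Phi$ be the standard normal distribution function, and let $z_\alpha$ be its $(1-\alpha)$-quantile. Fix $\delta_n>0$ with $\delta_n\to0$. A modulus is a nondecreasing function on $[0,\infty)$ that vanishes at $0$ and is continuous there. In the assumptions, bounds involving $\delta$ hold for all $n\ge1$ and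 $0<\delta\le\delta_n$. **Assumptions.** - (A1) There are square integrable scores $\dot\ell_G$, with $I_G=\mathbb E_G[\dot\ell_G\dot\ell_G^\top]$, and moduli $\phi_G$ such that, if $\|h\|_{I_G}\le\delta$, then $\theta_G+h\in\Theta$ and $\mathbb E_G\big[\big(\sqrt{p_{\theta_G+h}/p_{\theta_G}}-1-\tfrac12h^\top\dot\ell_G\big)^2\big]\le\phi_G(\delta)$. Moreover $\sup_{G\in\mathcal G}\sup_{0<\delta\le\delta_n}\phi_G(\delta)/\delta^2\to0$. - (A2) There are positive definite matrices $V_G$ and moduli $\omega_G$ such that, if $\|h\|_{V_G}\le\delta$ and $\theta_G+h\in\Theta$, then $\log(p_{\theta_G+h}/p_{\theta_G})$ is $G$-a.s. finite and $G$-integrable, and $\big|\mathbb E_G\log\frac{p_{\theta_G+h}}{p_{\theta_G}}+\tfrac12h^\top V_Gh\big|\le\omega_G(\delta)$. Moreover $\sup_{G}\sup_{0<\delta\le\delta_n}\omega_G(\delta)/\delta^2\to0$. - (A3) With $\widehat h=\widehat\theta_1-\theta_G$, $\limsup_n\sup_{G\in\mathcal G}\mathbb P_G\big(\max\{\|\widehat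 h\|_{I_G},\|\widehat h\|_{V_G},\|\widehat h\|_{V_G}^2/\|\widehat h\|_{I_G}\}>\delta_n\big)=0$, where $0/0=0$. - (A4) There are $p\ge2$, sequences $L_{n,G}$ and moduli $\nu_G$ such that, if $\|h\|_{I_G}\le\delta$, then $\log(p_{\theta_G+h}/p_{\theta_G})$ is $G$-a.s. finite, $\big\|\sqrt{p_{\theta_G+h}/p_{\theta_G}}-1-\tfrac12h^\top\dot\ell_G\big\|_{L^p(G)}\le L_{n,G}\delta$ and $\big\|\log(p_{\theta_G+h}/p_{\theta_G})\big\|_{L^{2p/(p-2)}(G)}\le\nu_G(\delta)$ (the $L^\infty$ norm if $p=2$). Moreover $\sup_{G}\sup_{0<\delta\le\delta_n}\max\{L_{n,G},1\}\nu_G(\delta)\to0$. - (A5) $\mathbb E_G\dot\ell_G=0$ for all $G\in\mathcal G$, and, with $0/0=0$, $$\lim_{\kappa\to\infty}\sup_{G\in\mathcal G}\sup_{t\in\mathbb R^d}\mathbb E_G\Big[\frac{\langle t,\dot\ell_G\rangle^2}{\|t\|_{I_G}^2}\min\Big\{1,\frac{|\langle t,\dot\ell_G\rangle|}{\kappa\|t\|_{I_G}}\Big\}\Big]=0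 .$$ **Conclusions.** Put $\mathfrak R_G(h)=\|h\|_{V_G}^2/\|h\|_{I_G}^2$ and $$r_{n,G}=\frac{\log(1/\alpha)}{n^{1/2}\|\widehat\theta_1-\theta_G\|_{I_G}}+\frac{n^{1/2}\|\widehat\theta_1-\theta_G\|_{V_G}^2}{2\|\widehat\theta_1-\theta_G\|_{I_G}}-z_\alpha .$$ 1. For all $G\in\mathcal G$ and $n\ge1$, whenever $\widehat\theta_1\ne\theta_G$, $\ \Phi(z_\alpha+r_{n,G})\ge\Phi\big(\sqrt{2\log(1/\alpha)\,\mathfrak R_G(\widehat\theta_1-\theta_G)}\big)$. 2. If $\inf_{G\in\mathcal G}\sqrt{2\log(1/\alpha)\,\lambda_{\min}(I_G^{-1/2}V_GI_G^{-1/2})}>z_\alpha$, then $\liminf_n\inf_{G\in\mathcal G}\mathbb P_G(\theta_G\in\mathrm{CI}_{n,\alpha})>1-\alpha$. 3. If $G\in\mathcal G\cap\mathcal P_\Theta$, and the model is quadratic mean differentiable at $\theta_G$ with score $\dot\ell_G$ in the classical sense $\int\big(\sqrt{p_{\theta_G+h}}-\sqrt{p_{\theta_G}}-\tfrac12h^\top\dot\ell_G\sqrt{p_{\theta_G}}\big)^2d\mu=o(\|h\|^2)$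 as $h\to0$, then $I_G=V_G$. 4. $\liminf_n\inf_{G\in\mathcal G\cap\mathcal P_\Theta}\mathbb P_G(\theta_G\in\mathrm{CI}_{n,\alpha})\ge\Phi(\sqrt{2\log(1/\alpha)})>1-\alpha$. 5. For every nonempty $\mathcal C\subseteq\mathcal G\cap\mathcal P_\Theta$, $\mathrm{CI}_{n,\alpha}$ is not asymptotically exact on $\mathcal C$: $\limsup_n\sup_{G\in\mathcal C}|\mathbb P_G(\theta_G\notin\mathrm{CI}_{n,\alpha})-\alpha|=0$ fails. -/

import Mathlib

open MeasureTheory ProbabilityTheory Filter Set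
open scoped ENNReal Topology Matrix

noncomputable section

namespace UniversalInference

/-- A statistical model indexed by a set `Θ ⊆ ℝᵈ`, dominated by a σ-finite base measure, with
densities `p θ`, `θ ∈ Θ` (values of `p θ` for `θ ∉ Θ` are irrelevant). -/
structure Model (d : ℕ) (Z : Type*) [MeasurableSpace Z] where
  Θ : Set (Fin d → ℝ)
  base : Measure Z
  sigmaFinite_base : SigmaFinite base
  p : (Fin d → ℝ) → Z → ℝ
  measurable_p : Measurable (fun x : Θ × Z => p x.1 x.2)
  p_nonneg : ∀ θ ∈ Θ, ∀ z, 0 ≤ p θ z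
  lintegral_p : ∀ θ ∈ Θ, ∫⁻ z, ENNReal.ofReal (p θ z) ∂base = 1

variable {d : ℕ} {Z : Type*} [MeasurableSpace Z]

/-- The distribution `P_θ` with density `p_θ`. -/
def Model.dist (M : Model d Z) (θ : Fin d → ℝ) : Measure Z :=
  M.base.withDensity (fun z => ENNReal.ofReal (M.p θ z))

/-- `G` belongs to the model. -/
def Model.Contains (M : Model d Z) (G : ProbabilityMeasure Z) : Prop :=
  ∃ θ ∈ M.Θ, (G : Measure Z) = M.dist θ

/-- `θ` minimizes the Kullback–Leibler divergence from `G` over the model. -/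
def Model.IsKLProjection (M : Model d Z) (G : ProbabilityMeasure Z) (θ : Fin d → ℝ) : Prop :=
  θ ∈ M.Θ ∧ ∀ θ' ∈ M.Θ,
    InformationTheory.klDiv (G : Measure Z) (M.dist θ) ≤
      InformationTheory.klDiv (G : Measure Z) (M.dist θ')

/-- The scaled norm `‖h‖_A = √(hᵀ A h)`. -/
def scaledNorm (A : Matrix (Fin d) (Fin d) ℝ) (h : Fin d → ℝ) : ℝ :=
  √(h ⬝ᵥ (A *ᵥ h))

/-- The information matrix `E_G[s sᵀ]` of a score function `s`. -/
def fisher (G : ProbabilityMeasure Z) (s : Z → Fin d → ℝ) : Matrix (Fin d) (Fin d) ℝ :=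
  Matrix.of fun i j => ∫ z, s z i * s z j ∂(G : Measure Z)

/-- A modulus of continuity on `[0, ∞)`. -/
def IsModulus (ω : ℝ → ℝ) : Prop :=
  ω 0 = 0 ∧ MonotoneOn ω (Ici 0) ∧ ContinuousWithinAt ω (Ici 0) 0

/-- `p_{θ+h}^{1/2} / p_θ^{1/2} - 1 - hᵀ s / 2`. -/
def Model.sqrtRemainder (M : Model d Z) (θ h : Fin d → ℝ) (s : Z → Fin d → ℝ) (z : Z) : ℝ :=
  √(M.p (θ + h) z) / √(M.p θ z) - 1 - (1 / 2) * (h ⬝ᵥ s z)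

/-- `log (p_{θ'} / p_θ)`, real valued; only used where both densities are positive. -/
def Model.logRatio (M : Model d Z) (θ' θ : Fin d → ℝ) (z : Z) : ℝ :=
  Real.log (M.p θ' z / M.p θ z)

/-- `log (p_{θ'} / p_θ)` as an extended real number (`-∞` where `p_{θ'} = 0`, and `+∞` where
`p_θ = 0 < p_{θ'}`). -/
def Model.extLogRatio (M : Model d Z) (θ' θ : Fin d → ℝ) (z : Z) : EReal :=
  ENNReal.log (ENNReal.ofReal (M.p θ' z) / ENNReal.ofReal (M.p θ z))

section Assumptions

variable (M : Model d Z) (𝒢 : Set (ProbabilityMeasure Z))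
  (θ : ProbabilityMeasure Z → Fin d → ℝ) (s : ProbabilityMeasure Z → Z → Fin d → ℝ)
  (V : ProbabilityMeasure Z → Matrix (Fin d) (Fin d) ℝ) (δ : ℕ → ℝ)

/-- Quadratic mean differentiability at `θ G` under `G`, uniformly over `G ∈ 𝒢`. -/
def QMD : Prop :=
  (∀ G ∈ 𝒢, MemLp (s G) 2 (G : Measure Z) ∧ ∀ᵐ z ∂(G : Measure Z), 0 < M.p (θ G) z) ∧
  ∃ φ : ProbabilityMeasure Z → ℝ → ℝ,
    (∀ G ∈ 𝒢, IsModulus (φ G)) ∧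
    (∀ G ∈ 𝒢, ∀ n, 1 ≤ n → ∀ r ∈ Ioc 0 (δ n), ∀ h, scaledNorm (fisher G (s G)) h ≤ r →
      θ G + h ∈ M.Θ ∧
      ∫⁻ z, ENNReal.ofReal ((M.sqrtRemainder (θ G) h (s G) z) ^ 2) ∂(G : Measure Z)
        ≤ ENNReal.ofReal (φ G r)) ∧
    ∀ ε > 0, ∀ᶠ n in atTop, ∀ G ∈ 𝒢, ∀ r ∈ Ioc 0 (δ n), φ G r ≤ ε * r ^ 2

/-- Quadratic expansion of the expected log-likelihood ratio around `θ G`, uniformly over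
`G ∈ 𝒢`, with `V G` positive definite. -/
def QuadraticExpansion : Prop :=
  (∀ G ∈ 𝒢, (V G).PosDef) ∧
  ∃ ω : ProbabilityMeasure Z → ℝ → ℝ,
    (∀ G ∈ 𝒢, IsModulus (ω G)) ∧
    (∀ G ∈ 𝒢, ∀ n, 1 ≤ n → ∀ r ∈ Ioc 0 (δ n), ∀ h, scaledNorm (V G) h ≤ r →
      θ G + h ∈ M.Θ →
      (∀ᵐ z ∂(G : Measure Z), 0 < M.p (θ G + h) z) ∧
      Integrable (M.logRatio (θ G + h) (θ G)) (G : Measure Z) ∧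
      |∫ z, M.logRatio (θ G + h) (θ G) z ∂(G : Measure Z) + (1 / 2) * (h ⬝ᵥ (V G *ᵥ h))|
        ≤ ω G r) ∧
    ∀ ε > 0, ∀ᶠ n in atTop, ∀ G ∈ 𝒢, ∀ r ∈ Ioc 0 (δ n), ω G r ≤ ε * r ^ 2

/-- Joint law of the two independent subsamples `D₁` (of size `k`) and `D₂` (of size `n`) of an
i.i.d. sample of size `k + n` from `G`. -/
def sampleLaw (G : ProbabilityMeasure Z) (k n : ℕ) : Measure ((Fin k → Z) × (Fin n → Z)) :=
  (Measure.pi fun _ : Fin k => (G : Measure Z)).prod (Measure.pi fun _ : Fin n => (G : Measure Z))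

variable (k : ℕ → ℕ) (est : (n : ℕ) → (Fin (k n) → Z) → Fin d → ℝ)

/-- The tail probability `τ_{n,G}(r)` of the error of the initial estimator. -/
def tailProb (n : ℕ) (G : ProbabilityMeasure Z) (r : ℝ) : ℝ≥0∞ :=
  sampleLaw G (k n) n {x |
    r < max (scaledNorm (fisher G (s G)) (est n x.1 - θ G))
      (max (scaledNorm (V G) (est n x.1 - θ G))
        (scaledNorm (V G) (est n x.1 - θ G) ^ 2 /
          scaledNorm (fisher G (s G)) (est n x.1 - θ G)))}

/-- Uniform consistency of the initial estimator at rate `δ`. -/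
def InitialConsistency : Prop :=
  limsup (fun n => ⨆ G ∈ 𝒢, tailProb θ s V k est n G (δ n)) atTop = 0

/-- Moment conditions on the square-root remainder and on the log-likelihood ratio, uniformly over
`G ∈ 𝒢`. For `q = 2` the conjugate exponent `2q / (q - 2)` is `∞`. -/
def MomentConditions : Prop :=
  ∃ q : ℝ, 2 ≤ q ∧ ∃ (L : ℕ → ProbabilityMeasure Z → ℝ) (ν : ProbabilityMeasure Z → ℝ → ℝ),
    (∀ G ∈ 𝒢, IsModulus (ν G)) ∧
    (∀ G ∈ 𝒢, ∀ n, 1 ≤ n → ∀ r ∈ Ioc 0 (δ n), ∀ h, scaledNorm (fisher G (s G)) h ≤ r →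
      θ G + h ∈ M.Θ →
      eLpNorm (M.sqrtRemainder (θ G) h (s G)) (ENNReal.ofReal q) (G : Measure Z)
        ≤ ENNReal.ofReal (L n G * r) ∧
      (∀ᵐ z ∂(G : Measure Z), 0 < M.p (θ G + h) z) ∧
      eLpNorm (M.logRatio (θ G + h) (θ G))
        (ENNReal.ofReal (2 * q) / ENNReal.ofReal (q - 2)) (G : Measure Z)
        ≤ ENNReal.ofReal (ν G r)) ∧
    ∀ ε > 0, ∀ᶠ n in atTop, ∀ G ∈ 𝒢, ∀ r ∈ Ioc 0 (δ n), max (L n G) 1 * ν G r ≤ ε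

/-- The uniform Lindeberg condition for the mean-zero scores `s G` under `G ∈ 𝒢`. -/
def UniformLindeberg : Prop :=
  (∀ G ∈ 𝒢, ∫ z, s G z ∂(G : Measure Z) = 0) ∧
  Tendsto (fun κ : ℝ => ⨆ G ∈ 𝒢, ⨆ t : Fin d → ℝ,
    ∫⁻ z, ENNReal.ofReal
      ((t ⬝ᵥ s G z) ^ 2 / √(∫ y, (t ⬝ᵥ s G y) ^ 2 ∂(G : Measure Z)) ^ 2 *
        min 1 (|t ⬝ᵥ s G z| / (κ * √(∫ y, (t ⬝ᵥ s G y) ^ 2 ∂(G : Measure Z)))))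
      ∂(G : Measure Z)) atTop (𝓝 0)

end Assumptions

/-- The universal confidence set computed from an initial estimate `θ₁` and the observations
`z` in `D₂`. -/
def universalCI (M : Model d Z) (α : ℝ) (θ₁ : Fin d → ℝ) {n : ℕ} (z : Fin n → Z) :
    Set (Fin d → ℝ) :=
  {θ | θ ∈ M.Θ ∧ ∑ i, M.extLogRatio θ₁ θ (z i) ≤ (Real.log (1 / α) : EReal)}

/-- `ℙ_G(θ_G ∈ CI_{n,α})`. -/
def coverage (M : Model d Z) (θ : ProbabilityMeasure Z → Fin d → ℝ) (k : ℕ → ℕ)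
    (est : (n : ℕ) → (Fin (k n) → Z) → Fin d → ℝ) (α : ℝ) (n : ℕ)
    (G : ProbabilityMeasure Z) : ℝ≥0∞ :=
  sampleLaw G (k n) n {x | θ G ∈ universalCI M α (est n x.1) x.2}

/-- `ℙ_G(θ_G ∉ CI_{n,α})`. -/
def miscoverage (M : Model d Z) (θ : ProbabilityMeasure Z → Fin d → ℝ) (k : ℕ → ℕ)
    (est : (n : ℕ) → (Fin (k n) → Z) → Fin d → ℝ) (α : ℝ) (n : ℕ)
    (G : ProbabilityMeasure Z) : ℝ≥0∞ :=
  sampleLaw G (k n) n {x | θ G ∉ universalCI M α (est n x.1) x.2}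

/-- Asymptotic uniform exactness at level `α` over the class `𝒞`. -/
def UniformlyExact (M : Model d Z) (θ : ProbabilityMeasure Z → Fin d → ℝ) (k : ℕ → ℕ)
    (est : (n : ℕ) → (Fin (k n) → Z) → Fin d → ℝ) (α : ℝ)
    (𝒞 : Set (ProbabilityMeasure Z)) : Prop :=
  limsup (fun n => ⨆ G ∈ 𝒞,
    ENNReal.ofReal |(miscoverage M θ k est α n G).toReal - α|) atTop = 0

/-- The standard normal distribution function. -/
def Φ (x : ℝ) : ℝ := cdf (gaussianReal 0 1) x

/-- The `1 - α` quantile of the standard normal distribution. -/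
def zQuantile (α : ℝ) : ℝ := sInf {x : ℝ | 1 - α ≤ Φ x}

/-- The remainder `r_{n,G}`, as a function of the error `h = θ̂₁ - θ_G`. -/
def rUI (I V : Matrix (Fin d) (Fin d) ℝ) (α : ℝ) (n : ℕ) (h : Fin d → ℝ) : ℝ :=
  Real.log (1 / α) / (√n * scaledNorm I h)
    + √n * scaledNorm V h ^ 2 / (2 * scaledNorm I h) - zQuantile α

/-- The ratio `‖h‖²_V / ‖h‖²_I`. -/
def varianceRatio (I V : Matrix (Fin d) (Fin d) ℝ) (h : Fin d → ℝ) : ℝ :=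
  scaledNorm V h ^ 2 / scaledNorm I h ^ 2

open scoped MatrixOrder in
/-- `I^{-1/2} V I^{-1/2}`, with the positive semidefinite square root of `I`. -/
def sandwich (I V : Matrix (Fin d) (Fin d) ℝ) : Matrix (Fin d) (Fin d) ℝ :=
  (CFC.sqrt I)⁻¹ * V * (CFC.sqrt I)⁻¹

/-- The smallest (real) eigenvalue. -/
def lambdaMin (A : Matrix (Fin d) (Fin d) ℝ) : ℝ := sInf (spectrum ℝ A)

/-- Le Cam's quadratic mean differentiability, with respect to the base measure, of the model at
the interior point `θ` with score `s`. -/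
def Model.ClassicalQMDAt (M : Model d Z) (θ : Fin d → ℝ) (s : Z → Fin d → ℝ) : Prop :=
  ∀ ε > 0, ∀ᶠ h in 𝓝 (0 : Fin d → ℝ),
    ∫⁻ z, ENNReal.ofReal
      ((√(M.p (θ + h) z) - √(M.p θ z) - (1 / 2) * (h ⬝ᵥ s z) * √(M.p θ z)) ^ 2) ∂M.base
      ≤ ENNReal.ofReal (ε * ‖h‖ ^ 2)

end UniversalInference

end

open UniversalInference

namespace UniversalInference

lemma Φ_eq_real (x : ℝ) : Φ x = (gaussianReal 0 1).real (Iic x) := cdf_eq_real _ x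

lemma Φ_mono : Monotone Φ := monotone_cdf _

lemma gaussianReal_pos_of_Ioo_subset {a b : ℝ} (hab : a < b) {A : Set ℝ} (h : Ioo a b ⊆ A) :
    0 < gaussianReal 0 1 A := by
  refine lt_of_lt_of_le ?_ (measure_mono h)
  refine pos_iff_ne_zero.2 fun h0 => ?_
  have := gaussianReal_absolutelyContinuous' 0 (v := 1) one_ne_zero h0
  simp at this
  linarith

lemma Φ_strictMono : StrictMono Φ := by
  intro a b hab
  rw [Φ_eq_real, Φ_eq_real, ← Iic_union_Ioc_eq_Iic hab.le,
    measureReal_union (Iic_disjoint_Ioc le_rfl) measurableSet_Ioc]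
  have : 0 < (gaussianReal 0 1).real (Ioc a b) :=
    ENNReal.toReal_pos (gaussianReal_pos_of_Ioo_subset hab Ioo_subset_Ioc_self).ne'
      (measure_ne_top _ _)
  linarith

lemma gaussianReal_singleton (x : ℝ) : gaussianReal 0 1 {x} = 0 :=
  gaussianReal_absolutelyContinuous 0 (v := 1) one_ne_zero (by simp)

lemma Φ_continuous : Continuous Φ := by
  rw [continuous_iff_continuousAt]
  intro x
  have h1 : (cdf (gaussianReal 0 1)).measure {x} = 0 := by
    rw [measure_cdf, gaussianReal_singleton]
  rw [StieltjesFunction.measure_singleton, ENNReal.ofReal_eq_zero] at h1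
  have hl : Function.leftLim Φ x = Φ x :=
    le_antisymm (Φ_mono.leftLim_le le_rfl) (by have := h1; exact sub_nonpos.1 this)
  refine continuousAt_iff_continuous_left'_right'.2
    ⟨(Φ_mono.continuousWithinAt_Iio_iff_leftLim_eq).2 hl, ?_⟩
  exact ((cdf (gaussianReal 0 1)).right_continuous x).mono Ioi_subset_Ici_self

/-- The Chernoff bound for the standard normal upper tail, in strict form. -/
lemma one_sub_exp_lt_Φ {x : ℝ} (hx : 0 < x) : 1 - Real.exp (-(x ^ 2 / 2)) < Φ x := by
  set γ := gaussianReal 0 1 with hγ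
  have hint : Integrable (fun y => Real.exp (x * y)) γ := integrable_exp_mul_gaussianReal x
  have hmgf : ∫ y, Real.exp (x * y) ∂γ = Real.exp (x ^ 2 / 2) := by
    have := mgf_gaussianReal (X := id) (p := γ) (μ := 0) (v := 1) (by simp [hγ]) x
    simpa [mgf] using this
  have hpos : 0 < ∫ y in Iic x, Real.exp (x * y) ∂γ := by
    rw [setIntegral_pos_iff_support_of_nonneg_ae
      (ae_of_all _ fun y => (Real.exp_pos _).le) hint.integrableOn]
    refine gaussianReal_pos_of_Ioo_subset (a := x - 1) (b := x) (by linarith) fun y hy => ?_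
    exact ⟨(Real.exp_pos _).ne', hy.2.le⟩
  have hle : Real.exp (x ^ 2) * γ.real (Ioi x) ≤ ∫ y in Ioi x, Real.exp (x * y) ∂γ := by
    have h := setIntegral_mono_on (μ := γ) (s := Ioi x) (f := fun _ => Real.exp (x ^ 2))
      (g := fun y => Real.exp (x * y)) (integrable_const _).integrableOn hint.integrableOn
      measurableSet_Ioi fun y hy => Real.exp_le_exp.2 (by nlinarith [mem_Ioi.1 hy])
    simpa [mul_comm] using h
  have hadd := integral_add_compl (measurableSet_Iic (a := x)) hint
  rw [compl_Iic, hmgf] at hadd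
  have hc : Φ x + γ.real (Ioi x) = 1 := by
    rw [Φ_eq_real, ← compl_Iic]
    exact probReal_add_probReal_compl measurableSet_Iic
  have h1 : Real.exp (x ^ 2) * γ.real (Ioi x) < Real.exp (x ^ 2 / 2) := by linarith
  have h2 : γ.real (Ioi x) < Real.exp (-(x ^ 2 / 2)) := by
    have e : Real.exp (x ^ 2 / 2) = Real.exp (x ^ 2) * Real.exp (-(x ^ 2 / 2)) := by
      rw [← Real.exp_add]; congr 1; ring
    rw [e] at h1
    exact lt_of_mul_lt_mul_left h1 (Real.exp_pos _).le
  linarith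

lemma exists_lt_of_zQuantile_lt {α c : ℝ} (hα : α ∈ Ioo (0 : ℝ) 1) (h : zQuantile α < c) :
    1 - α < Φ c := by
  have hne : {x : ℝ | 1 - α ≤ Φ x}.Nonempty := by
    have h1 : Tendsto Φ atTop (𝓝 1) := tendsto_cdf_atTop _
    obtain ⟨x, hx⟩ := (h1.eventually (lt_mem_nhds (show 1 - α < 1 by linarith [hα.1]))).exists
    exact ⟨x, hx.le⟩
  obtain ⟨x, hx, hxc⟩ := exists_lt_of_csInf_lt hne h
  exact lt_of_le_of_lt hx (Φ_strictMono hxc)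

lemma norm_exp_I_mul_sub_taylor_two_le (x : ℝ) :
    ‖Complex.exp (x * Complex.I) - 1 - x * Complex.I + x ^ 2 / 2‖ ≤
      4 * (x ^ 2 * min 1 |x|) := by
  rcases le_total |x| 1 with hx | hx
  · have h := Complex.exp_bound (x := x * Complex.I) (by simpa using hx) (n := 3) (by norm_num)
    have e : Complex.exp (x * Complex.I) - ∑ m ∈ Finset.range 3, (x * Complex.I) ^ m / m.factorial
        = Complex.exp (x * Complex.I) - 1 - x * Complex.I + x ^ 2 / 2 := by
      simp [Finset.sum_range_succ, mul_pow]; ring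
    rw [e] at h
    refine h.trans ?_
    rw [min_eq_right hx]
    simp [Nat.factorial]
    have : 0 ≤ |x| ^ 3 := by positivity
    have e : x ^ 2 * |x| = |x| ^ 3 := by rw [← sq_abs]; ring
    rw [e]; nlinarith
  · rw [min_eq_left hx, mul_one]
    have h1 : ‖Complex.exp (x * Complex.I) - 1 - x * Complex.I + x ^ 2 / 2‖ ≤
        ‖Complex.exp (x * Complex.I)‖ + ‖(1 : ℂ)‖ + ‖x * Complex.I‖ + ‖(x : ℂ) ^ 2 / 2‖ :=
      (norm_add_le _ _).trans (add_le_add_left ((norm_sub_le _ _).trans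
        (add_le_add_left (norm_sub_le _ _) _)) _)
    refine h1.trans ?_
    simp [Complex.norm_exp_ofReal_mul_I]
    rw [← sq_abs]
    nlinarith [sq_abs x]

lemma norm_charFun_sub_taylor_two_le {μ : Measure ℝ} [IsProbabilityMeasure μ]
    (h2 : Integrable (fun x => x ^ 2) μ) (h0 : ∫ x, x ∂μ = 0) (h1 : ∫ x, x ^ 2 ∂μ = 1) (u : ℝ) :
    ‖charFun μ u - 1 + u ^ 2 / 2‖ ≤ 4 * u ^ 2 * ∫ x, x ^ 2 * min 1 (|u| * |x|) ∂μ := by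
  have hm : MemLp (fun x : ℝ => x) 2 μ := (memLp_two_iff_integrable_sq (by fun_prop)).2 h2
  have hi : Integrable (fun x : ℝ => x) μ := hm.integrable one_le_two
  have hexp : Integrable (fun x : ℝ => Complex.exp ((u * x : ℝ) * Complex.I)) μ := by
    refine Integrable.of_bound (by fun_prop) 1 (ae_of_all _ fun x => ?_)
    rw [Complex.norm_exp_ofReal_mul_I]
  have e : charFun μ u - 1 + u ^ 2 / 2 =
      ∫ x, (Complex.exp ((u * x : ℝ) * Complex.I) - 1 - (u * x : ℝ) * Complex.I
        + ((u * x : ℝ) : ℂ) ^ 2 / 2) ∂μ := by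
    have i1 : Integrable (fun x : ℝ => ((u * x : ℝ) : ℂ) * Complex.I) μ :=
      ((hi.const_mul u).ofReal).mul_const _
    have i2 : Integrable (fun x : ℝ => ((u * x : ℝ) : ℂ) ^ 2 / 2) μ := by
      have := ((h2.const_mul (u ^ 2)).ofReal (𝕜 := ℂ)).div_const 2
      refine this.congr (ae_of_all _ fun x => ?_)
      simp only [RCLike.ofReal_mul, RCLike.ofReal_pow]
      simp [mul_pow]
    have i3 : Integrable (fun x : ℝ => Complex.exp ((u * x : ℝ) * Complex.I) - 1) μ :=
      hexp.sub (integrable_const _)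
    have i4 : Integrable (fun x : ℝ =>
        Complex.exp ((u * x : ℝ) * Complex.I) - 1 - (u * x : ℝ) * Complex.I) μ := i3.sub i1
    rw [integral_add i4 i2, integral_sub i3 i1, integral_sub hexp (integrable_const _)]
    have e1 : ∫ x, ((u * x : ℝ) : ℂ) * Complex.I ∂μ = 0 := by
      rw [integral_mul_const, integral_complex_ofReal, integral_const_mul, h0]; simp
    have e2 : ∫ x : ℝ, ((u * x : ℝ) : ℂ) ^ 2 / 2 ∂μ = ((u : ℂ) ^ 2 / 2 : ℂ) := by
      have : ∀ x : ℝ, ((u * x : ℝ) : ℂ) ^ 2 / 2 = ((u ^ 2 / 2 * x ^ 2 : ℝ) : ℂ) := by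
        intro x; push_cast; ring
      simp_rw [this]
      rw [integral_complex_ofReal, integral_const_mul, h1]; simp
    rw [e1, e2, charFun_apply_real]
    simp
  rw [e, ← integral_const_mul]
  refine norm_integral_le_of_norm_le ?_ (ae_of_all _ fun x => ?_)
  · refine ((h2.mono' (by fun_prop) (ae_of_all _ fun x => ?_)).const_mul _)
    rw [Real.norm_eq_abs, abs_of_nonneg (by positivity)]
    exact mul_le_of_le_one_right (by positivity) (min_le_left _ _)
  · refine (norm_exp_I_mul_sub_taylor_two_le (u * x)).trans (le_of_eq ?_)
    rw [abs_mul]; ring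

/-- A central limit theorem along a sequence of row distributions satisfying Lindeberg's
condition. -/
lemma tendsto_measure_Iic_of_lindeberg (μ : ℕ → Measure ℝ) [∀ n, IsProbabilityMeasure (μ n)]
    (h2 : ∀ n, Integrable (fun x => x ^ 2) (μ n)) (h0 : ∀ n, ∫ x, x ∂(μ n) = 0)
    (h1 : ∀ n, ∫ x, x ^ 2 ∂(μ n) = 1)
    (hL : ∀ ε > 0, ∃ κ > 0, ∀ n, ∫ x, x ^ 2 * min 1 (|x| / κ) ∂(μ n) ≤ ε) (c : ℝ) :
    Tendsto (fun n : ℕ => (Measure.pi fun _ : Fin n => μ n).real {x | (√n)⁻¹ * ∑ i, x i ≤ c})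
      atTop (𝓝 (Φ c)) := by
  let P : ℕ → ProbabilityMeasure ℝ := fun n =>
    ⟨(Measure.pi fun _ : Fin n => μ n).map (fun x => (√n)⁻¹ * ∑ i, x i),
      Measure.isProbabilityMeasure_map (by fun_prop)⟩
  let γ : ProbabilityMeasure ℝ := ⟨gaussianReal 0 1, inferInstance⟩
  have hlim : Tendsto P atTop (𝓝 γ) := by
    rw [ProbabilityMeasure.tendsto_iff_tendsto_charFun]
    intro t
    have hc : ∀ n, charFun (P n : Measure ℝ) t = (1 + (charFun (μ n) ((√n)⁻¹ * t) - 1)) ^ n := by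
      intro n
      change charFun ((Measure.pi fun _ : Fin n => μ n).map (fun x => (√n)⁻¹ * ∑ i, x i)) t = _
      rw [charFun_map_mul_comp (f := fun x : Fin n → ℝ => ∑ i, x i) (by fun_prop),
        charFun_map_sum_pi_eq_prod]
      simp
    simp_rw [hc]
    change Tendsto _ _ (𝓝 (charFun (gaussianReal 0 1) t))
    rw [charFun_gaussianReal]
    have hexp : (t * (0 : ℝ) * Complex.I - (1 : NNReal) * t ^ 2 / 2 : ℂ) = -(t ^ 2 / 2) := by
      simp
    rw [hexp]
    refine Complex.tendsto_one_add_pow_exp_of_tendsto ?_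
    have hbd : ∀ᶠ n : ℕ in atTop, ‖n * (charFun (μ n) ((√n)⁻¹ * t) - 1) - (-(t ^ 2 / 2) : ℂ)‖ ≤
        4 * t ^ 2 * ∫ x, x ^ 2 * min 1 (|(√n)⁻¹ * t| * |x|) ∂(μ n) := by
      filter_upwards [eventually_gt_atTop 0] with n hn
      have hn' : (0 : ℝ) < n := by exact_mod_cast hn
      have hsq : ((√n)⁻¹ * t) ^ 2 = t ^ 2 / n := by
        rw [mul_pow, inv_pow, Real.sq_sqrt hn'.le]; field_simp
      have := norm_charFun_sub_taylor_two_le (h2 n) (h0 n) (h1 n) ((√n)⁻¹ * t)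
      have e : n * (charFun (μ n) ((√n)⁻¹ * t) - 1) - (-(t ^ 2 / 2) : ℂ) =
          n * (charFun (μ n) ((√n)⁻¹ * t) - 1 + (((√n)⁻¹ * t : ℝ) : ℂ) ^ 2 / 2) := by
        have : (((√n)⁻¹ * t : ℝ) : ℂ) ^ 2 = t ^ 2 / n := by
          rw [← Complex.ofReal_pow, hsq]; push_cast; rfl
        rw [this]
        have : (n : ℂ) ≠ 0 := by exact_mod_cast hn.ne'
        field_simp
        ring
      rw [e, norm_mul]
      simp only [Complex.norm_natCast]
      calc _ ≤ (n : ℝ) * (4 * ((√n)⁻¹ * t) ^ 2 *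
            ∫ x, x ^ 2 * min 1 (|(√n)⁻¹ * t| * |x|) ∂(μ n)) := by gcongr
        _ = _ := by rw [hsq]; field_simp
    rw [tendsto_iff_norm_sub_tendsto_zero]
    refine squeeze_zero' (Eventually.of_forall fun _ => norm_nonneg _) hbd ?_
    rw [show (0 : ℝ) = 4 * t ^ 2 * 0 by simp]
    refine Tendsto.const_mul _ ?_
    rw [Metric.tendsto_atTop]
    intro ε hε
    obtain ⟨κ, hκ, hκ'⟩ := hL (ε / 2) (by positivity)
    have hsm : ∀ᶠ n : ℕ in atTop, |(√n)⁻¹ * t| ≤ 1 / κ := by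
      have : Tendsto (fun n : ℕ => |(√n)⁻¹ * t|) atTop (𝓝 0) := by
        have h := (((tendsto_inv_atTop_zero.comp (Real.tendsto_sqrt_atTop.comp
          tendsto_natCast_atTop_atTop)).mul_const t).abs)
        simpa using h
      exact (this.eventually (gt_mem_nhds (show 0 < 1 / κ by positivity))).mono fun _ h => h.le
    obtain ⟨N, hN⟩ := eventually_atTop.1 hsm
    refine ⟨N, fun n hn => ?_⟩
    have hnn : 0 ≤ ∫ x, x ^ 2 * min 1 (|(√n)⁻¹ * t| * |x|) ∂(μ n) :=
      integral_nonneg fun x => by positivity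
    rw [Real.dist_eq, sub_zero, abs_of_nonneg hnn]
    refine lt_of_le_of_lt (le_trans ?_ (hκ' n)) (by linarith)
    have hii : ∀ b : ℝ, 0 ≤ b → Integrable (fun x => x ^ 2 * min 1 (b * |x|)) (μ n) := fun b hb => by
      refine (h2 n).mono' (by fun_prop) (ae_of_all _ fun x => ?_)
      rw [Real.norm_eq_abs, abs_of_nonneg (by positivity)]
      exact mul_le_of_le_one_right (by positivity) (min_le_left _ _)
    refine integral_mono (hii _ (abs_nonneg _)) ?_ fun x => ?_
    · refine (hii (1 / κ) (by positivity)).congr (ae_of_all _ fun x => ?_)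
      simp only; rw [div_mul_eq_mul_div, one_mul]
    · have : |(√n)⁻¹ * t| * |x| ≤ |x| / κ := by
        rw [show |x| / κ = 1 / κ * |x| by ring]
        exact mul_le_mul_of_nonneg_right (hN n hn) (abs_nonneg _)
      simp only
      gcongr
  have h := ProbabilityMeasure.tendsto_measure_of_null_frontier_of_tendsto' hlim (E := Iic c)
    (by rw [frontier_Iic]; exact gaussianReal_singleton c)
  have h' := (ENNReal.tendsto_toReal (measure_ne_top (γ : Measure ℝ) _)).comp h
  rw [Φ_eq_real]
  refine h'.congr fun n => ?_
  change (((Measure.pi fun _ : Fin n => μ n).map (fun x => (√n)⁻¹ * ∑ i, x i)) (Iic c)).toReal = _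
  rw [Measure.map_apply (by fun_prop) measurableSet_Iic]
  rfl

/-- A uniform central limit theorem over a class of distributions satisfying Lindeberg's
condition uniformly. -/
lemma eventually_forall_measure_Iic_of_lindeberg (A : Set (ProbabilityMeasure ℝ))
    (h2 : ∀ μ ∈ A, Integrable (fun x => x ^ 2) (μ : Measure ℝ))
    (h0 : ∀ μ ∈ A, ∫ x, x ∂(μ : Measure ℝ) = 0)
    (h1 : ∀ μ ∈ A, ∫ x, x ^ 2 ∂(μ : Measure ℝ) = 1)
    (hL : ∀ ε > 0, ∃ κ > 0, ∀ μ ∈ A, ∫ x, x ^ 2 * min 1 (|x| / κ) ∂(μ : Measure ℝ) ≤ ε)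
    (c : ℝ) {η : ℝ} (hη : 0 < η) :
    ∀ᶠ n : ℕ in atTop, ∀ μ ∈ A, Φ c - η ≤
      (Measure.pi fun _ : Fin n => (μ : Measure ℝ)).real {x | (√n)⁻¹ * ∑ i, x i ≤ c} := by
  rcases A.eq_empty_or_nonempty with rfl | ⟨μ₀, hμ₀⟩
  · simp
  have hch : ∀ n : ℕ, ∃ ν ∈ A, (∃ μ ∈ A, ¬ (Φ c - η ≤
      (Measure.pi fun _ : Fin n => (μ : Measure ℝ)).real {x | (√n)⁻¹ * ∑ i, x i ≤ c})) →
      ¬ (Φ c - η ≤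
      (Measure.pi fun _ : Fin n => (ν : Measure ℝ)).real {x | (√n)⁻¹ * ∑ i, x i ≤ c}) := by
    intro n
    by_cases h : ∃ μ ∈ A, ¬ (Φ c - η ≤
      (Measure.pi fun _ : Fin n => (μ : Measure ℝ)).real {x | (√n)⁻¹ * ∑ i, x i ≤ c})
    · obtain ⟨μ, hμ, h'⟩ := h
      exact ⟨μ, hμ, fun _ => h'⟩
    · exact ⟨μ₀, hμ₀, fun h' => absurd h' h⟩
  choose ν hνA hν using hch
  have hlim := tendsto_measure_Iic_of_lindeberg (fun n => (ν n : Measure ℝ))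
    (fun n => h2 _ (hνA n)) (fun n => h0 _ (hνA n)) (fun n => h1 _ (hνA n))
    (fun ε hε => let ⟨κ, hκ, h⟩ := hL ε hε; ⟨κ, hκ, fun n => h _ (hνA n)⟩) c
  filter_upwards [hlim.eventually (lt_mem_nhds (show Φ c - η < Φ c by linarith))] with n hn μ hμ
  by_contra hcon
  exact hν n ⟨μ, hμ, hcon⟩ hn.le

section LogInequalities

lemma le_one_add_mul_log_one_add {w : ℝ} (hw : -1 < w) : w ≤ (1 + w) * Real.log (1 + w) := by
  have h0 : 0 < 1 + w := by linarith
  have h := Real.one_sub_inv_le_log_of_pos h0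
  have h' := mul_le_mul_of_nonneg_left h h0.le
  have : (1 + w) * (1 - (1 + w)⁻¹) = w := by field_simp; ring
  linarith

lemma log_one_add_le {w : ℝ} (hw : -1 < w) : Real.log (1 + w) ≤ w := by
  have := Real.log_le_sub_one_of_pos (show 0 < 1 + w by linarith)
  linarith

lemma mul_log_one_add_nonneg {w : ℝ} (hw : -1 < w) : 0 ≤ w * Real.log (1 + w) := by
  rcases le_total 0 w with h | h
  · exact mul_nonneg h (Real.log_nonneg (by linarith))
  · exact mul_nonneg_of_nonpos_of_nonpos h (Real.log_nonpos (by linarith) (by linarith))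

lemma abs_log_one_add_sub_le {w : ℝ} (hw : -1 < w) :
    |Real.log (1 + w) - w| ≤ |w| * |Real.log (1 + w)| := by
  rw [← abs_mul, abs_of_nonneg (mul_log_one_add_nonneg hw),
    abs_of_nonpos (by linarith [log_one_add_le hw])]
  linarith [le_one_add_mul_log_one_add hw]

lemma abs_log_one_add_sub_le_abs {w : ℝ} (hw : -(1 / 2) ≤ w) :
    |Real.log (1 + w) - w| ≤ |w| := by
  have hw' : -1 < w := by linarith
  rw [abs_of_nonpos (by linarith [log_one_add_le hw'])]
  rcases le_total 0 w with h | h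
  · rw [abs_of_nonneg h]
    linarith [Real.log_nonneg (show 1 ≤ 1 + w by linarith)]
  · rw [abs_of_nonpos h]
    by_contra! hc
    nlinarith [le_one_add_mul_log_one_add hw']

lemma two_mul_log_one_add_sub_bounds {w : ℝ} (hw : -1 < w) :
    0 ≤ w * (Real.log (1 + w) - w + w ^ 2 / 2) ∧
      0 ≤ w * (w + w ^ 2 / 2 - (1 + w) * Real.log (1 + w)) := by
  have h0 : 0 < 1 + w := by linarith
  have e : (w + w ^ 2 / 2) = (1 + w) * ((1 + w - (1 + w)⁻¹) / 2) := by field_simp; ring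
  rcases le_total 0 w with h | h
  · refine ⟨mul_nonneg h ?_, mul_nonneg h ?_⟩
    · have h1 := Real.le_log_one_add_of_nonneg h
      have : w - w ^ 2 / 2 ≤ 2 * w / (w + 2) := by
        rw [le_div_iff₀ (by linarith)]
        nlinarith [pow_nonneg h 3]
      linarith
    · have h1 : Real.log (1 + w) ≤ Real.sinh (Real.log (1 + w)) :=
        Real.self_le_sinh_iff.2 (Real.log_nonneg (by linarith))
      rw [Real.sinh_log h0] at h1
      rw [e]
      nlinarith
  · refine ⟨mul_nonneg_of_nonpos_of_nonpos h ?_, mul_nonneg_of_nonpos_of_nonpos h ?_⟩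
    · have hy : 0 ≤ -w / (1 + w) := div_nonneg (by linarith) h0.le
      have h1 := Real.le_log_one_add_of_nonneg hy
      have e1 : 1 + -w / (1 + w) = (1 + w)⁻¹ := by field_simp; ring
      have h2 : 0 < w + 2 := by linarith
      have e2 : 2 * (-w / (1 + w)) / (-w / (1 + w) + 2) = -(2 * w / (w + 2)) := by
        have : -w / (1 + w) + 2 = (w + 2) / (1 + w) := by field_simp; ring
        rw [this]; field_simp
      rw [e1, e2, Real.log_inv] at h1
      have : 2 * w / (w + 2) ≤ w - w ^ 2 / 2 := by
        rw [div_le_iff₀ h2]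
        nlinarith [pow_nonneg (neg_nonneg.2 h) 3]
      linarith
    · have h1 : Real.sinh (Real.log (1 + w)) ≤ Real.log (1 + w) :=
        Real.sinh_le_self_iff.2 (Real.log_nonpos (by linarith) (by linarith))
      rw [Real.sinh_log h0] at h1
      rw [e]
      nlinarith

lemma abs_log_one_add_sub_add_le {w : ℝ} (hw : -1 < w) :
    |Real.log (1 + w) - w + w ^ 2 / 2| ≤ |w| * |Real.log (1 + w) - w| := by
  obtain ⟨h1, h2⟩ := two_mul_log_one_add_sub_bounds hw
  rw [abs_of_nonpos (show Real.log (1 + w) - w ≤ 0 by linarith [log_one_add_le hw])]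
  rcases lt_trichotomy w 0 with h | h | h
  · have h1' := nonpos_of_mul_nonneg_right h1 h
    have h2' := nonpos_of_mul_nonneg_right h2 h
    rw [abs_of_nonpos h1', abs_of_neg h]
    linarith
  · simp [h]
  · have h1' := nonneg_of_mul_nonneg_right h1 h
    have h2' := nonneg_of_mul_nonneg_right h2 h
    rw [abs_of_nonneg h1', abs_of_pos h]
    linarith

/-- Comparison of a log-likelihood ratio `X = 2 log (1 + g / 2 + R)` with its linearization `g`.
The residual `R'` along the same direction, at a scale `m ≥ 16` times as large, controls the event
that the linearization is close to `-2`. -/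
lemma abs_two_mul_log_sub_le {g R R' m T : ℝ} (hW : -1 < g / 2 + R) (hm : 16 ≤ m)
    (hR' : -1 ≤ m * g / 2 + R') (hT : 0 ≤ T) :
    |2 * Real.log (1 + (g / 2 + R)) - g| ≤ 4 * |R| + 4 * (|R| * |2 * Real.log (1 + (g / 2 + R))|)
      + 8 / m * (|R'| * |2 * Real.log (1 + (g / 2 + R))|)
      + T * |2 * Real.log (1 + (g / 2 + R))| + {x : ℝ | T < |x|}.indicator (fun x => |x|) g := by
  set w := g / 2 + R with hw
  set l := Real.log (1 + w)
  have hind : 0 ≤ {x : ℝ | T < |x|}.indicator (fun x => |x|) g :=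
    indicator_nonneg (fun x _ => abs_nonneg x) g
  have hl2 : |2 * l| = 2 * |l| := by rw [abs_mul]; simp
  have hl := abs_nonneg l
  have hR := abs_nonneg R
  have hm0 : 0 < m := by linarith
  have tri : |2 * l - g| ≤ 2 * |l - w| + 2 * |R| := by
    have : 2 * l - g = 2 * (l - w) + 2 * R := by rw [hw]; ring
    rw [this]
    refine (abs_add_le _ _).trans ?_
    rw [abs_mul, abs_mul]; simp
  have hq : 0 ≤ 8 / m * (|R'| * |2 * l|) := by positivity
  have p1 : 0 ≤ |R| * |l| := by positivity
  have p2 : 0 ≤ T * |l| := by positivity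
  rcases lt_or_ge w (-(1 / 2)) with h | h
  · have h1 : |l - w| ≤ |l| := (abs_log_one_add_sub_le hW).trans
      (mul_le_of_le_one_left hl (abs_le.2 ⟨by linarith, by linarith⟩))
    rcases lt_or_ge R (-(1 / 4)) with h2 | h2
    · have : 1 / 4 ≤ |R| := by rw [abs_of_neg (by linarith)]; linarith
      rw [hl2] at *
      nlinarith
    · have hg : g < -(1 / 2) := by linarith
      have h3 : m / 8 ≤ |R'| := by
        refine le_trans ?_ (le_abs_self R')
        nlinarith
      have h4 : 1 ≤ 8 / m * |R'| := by
        calc (1 : ℝ) = 8 / m * (m / 8) := by field_simp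
          _ ≤ _ := by gcongr
      have h5 : |2 * l| ≤ 8 / m * (|R'| * |2 * l|) := by
        rw [← mul_assoc]
        exact le_mul_of_one_le_left (abs_nonneg _) h4
      rw [hl2] at *
      nlinarith
  · rcases le_or_gt |g| T with h2 | h2
    · have h1 := abs_log_one_add_sub_le hW
      have h3 : |w| ≤ |g| / 2 + |R| := by
        rw [hw]; refine (abs_add_le _ _).trans ?_
        rw [abs_div]; simp
      have h4 : |w| * |l| ≤ (T / 2 + |R|) * |l| := by gcongr; linarith
      rw [hl2] at *
      nlinarith
    · have h1 : |l - w| ≤ |w| := abs_log_one_add_sub_le_abs h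
      have h3 : |w| ≤ |g| / 2 + |R| := by
        rw [hw]; refine (abs_add_le _ _).trans ?_
        rw [abs_div]; simp
      have h4 : {x : ℝ | T < |x|}.indicator (fun x => |x|) g = |g| :=
        indicator_of_mem (show g ∈ {x : ℝ | T < |x|} from h2) _
      rw [h4, hl2] at *
      nlinarith

end LogInequalities

section Basics

variable {d : ℕ} {Z : Type*} [MeasurableSpace Z]

lemma Model.measurable_density (M : Model d Z) {θ : Fin d → ℝ} (hθ : θ ∈ M.Θ) :
    Measurable (M.p θ) :=
  M.measurable_p.comp (g := fun x : M.Θ × Z => M.p x.1 x.2) (f := fun z => (⟨θ, hθ⟩, z))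
    (measurable_const.prodMk measurable_id)

lemma Model.measurable_logRatio (M : Model d Z) {θ θ' : Fin d → ℝ} (hθ : θ ∈ M.Θ)
    (hθ' : θ' ∈ M.Θ) : Measurable (M.logRatio θ' θ) :=
  Real.measurable_log.comp ((M.measurable_density hθ').div (M.measurable_density hθ))

lemma dotProduct_aestronglyMeasurable {μ : Measure Z} {s : Z → Fin d → ℝ}
    (hs : AEStronglyMeasurable s μ) (t : Fin d → ℝ) :
    AEStronglyMeasurable (fun z => t ⬝ᵥ s z) μ := by
  have : Continuous fun x : Fin d → ℝ => t ⬝ᵥ x := by fun_prop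
  exact this.comp_aestronglyMeasurable hs

lemma Model.aestronglyMeasurable_sqrtRemainder (M : Model d Z) {μ : Measure Z} {θ h : Fin d → ℝ}
    {s : Z → Fin d → ℝ} (hθ : θ ∈ M.Θ) (hθ' : θ + h ∈ M.Θ) (hs : AEStronglyMeasurable s μ) :
    AEStronglyMeasurable (M.sqrtRemainder θ h s) μ := by
  have h1 : Measurable fun z => √(M.p (θ + h) z) / √(M.p θ z) - 1 :=
    ((M.measurable_density hθ').sqrt.div (M.measurable_density hθ).sqrt).sub_const 1
  exact h1.aestronglyMeasurable.sub ((dotProduct_aestronglyMeasurable hs h).const_mul _)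

lemma Model.logRatio_eq (M : Model d Z) {θ h : Fin d → ℝ} (s : Z → Fin d → ℝ) {z : Z}
    (h0 : 0 < M.p θ z) (h1 : 0 < M.p (θ + h) z) :
    -1 < (h ⬝ᵥ s z) / 2 + M.sqrtRemainder θ h s z ∧
    M.logRatio (θ + h) θ z =
      2 * Real.log (1 + ((h ⬝ᵥ s z) / 2 + M.sqrtRemainder θ h s z)) := by
  have e : 1 + ((h ⬝ᵥ s z) / 2 + M.sqrtRemainder θ h s z) = √(M.p (θ + h) z / M.p θ z) := by
    rw [Real.sqrt_div h1.le, Model.sqrtRemainder]; ring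
  have hp : 0 < √(M.p (θ + h) z / M.p θ z) := Real.sqrt_pos.2 (div_pos h1 h0)
  refine ⟨by linarith, ?_⟩
  rw [e, Real.log_sqrt (div_pos h1 h0).le, Model.logRatio]
  ring

lemma Model.neg_one_le_sqrtRemainder (M : Model d Z) (θ h : Fin d → ℝ) (s : Z → Fin d → ℝ)
    (z : Z) : -1 ≤ (h ⬝ᵥ s z) / 2 + M.sqrtRemainder θ h s z := by
  have : 0 ≤ √(M.p (θ + h) z) / √(M.p θ z) := by positivity
  rw [Model.sqrtRemainder]; linarith

lemma scaledNorm_nonneg (A : Matrix (Fin d) (Fin d) ℝ) (h : Fin d → ℝ) : 0 ≤ scaledNorm A h :=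
  Real.sqrt_nonneg _

lemma scaledNorm_smul (A : Matrix (Fin d) (Fin d) ℝ) (c : ℝ) (h : Fin d → ℝ) :
    scaledNorm A (c • h) = |c| * scaledNorm A h := by
  rw [scaledNorm, Matrix.mulVec_smul, smul_dotProduct, dotProduct_smul, smul_smul, smul_eq_mul,
    Real.sqrt_mul (mul_self_nonneg c), Real.sqrt_mul_self_eq_abs, scaledNorm]

lemma memLp_dotProduct {μ : Measure Z} {s : Z → Fin d → ℝ} (hs : MemLp s 2 μ) (t : Fin d → ℝ) :
    MemLp (fun z => t ⬝ᵥ s z) 2 μ := by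
  simp only [dotProduct]
  exact memLp_finsetSum _ fun i _ => (MemLp.eval hs i).const_mul (t i)

lemma dotProduct_fisher_mulVec {G : ProbabilityMeasure Z} {s : Z → Fin d → ℝ}
    (hs : MemLp s 2 (G : Measure Z)) (t : Fin d → ℝ) :
    t ⬝ᵥ (fisher G s *ᵥ t) = ∫ z, (t ⬝ᵥ s z) ^ 2 ∂(G : Measure Z) := by
  have hi : ∀ i j, Integrable (fun z => s z i * s z j) (G : Measure Z) := fun i j =>
    (MemLp.eval hs i).integrable_mul (MemLp.eval hs j)
  have e : ∀ z, (t ⬝ᵥ s z) ^ 2 = ∑ i, ∑ j, t i * (t j * (s z i * s z j)) := by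
    intro z
    rw [sq, dotProduct, Finset.sum_mul_sum]
    refine Finset.sum_congr rfl fun i _ => Finset.sum_congr rfl fun j _ => ?_
    ring
  simp_rw [e]
  rw [integral_finsetSum _ fun i _ => integrable_finsetSum _ fun j _ =>
    ((hi i j).const_mul _).const_mul _]
  simp only [dotProduct, Matrix.mulVec, fisher, Matrix.of_apply]
  refine Finset.sum_congr rfl fun i _ => ?_
  rw [integral_finsetSum _ fun j _ => ((hi i j).const_mul _).const_mul _, Finset.mul_sum]
  refine Finset.sum_congr rfl fun j _ => ?_
  rw [integral_const_mul, integral_const_mul]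
  ring

lemma scaledNorm_fisher {G : ProbabilityMeasure Z} {s : Z → Fin d → ℝ}
    (hs : MemLp s 2 (G : Measure Z)) (t : Fin d → ℝ) :
    scaledNorm (fisher G s) t = √(∫ z, (t ⬝ᵥ s z) ^ 2 ∂(G : Measure Z)) := by
  rw [scaledNorm, dotProduct_fisher_mulVec hs]

lemma scaledNorm_fisher_sq {G : ProbabilityMeasure Z} {s : Z → Fin d → ℝ}
    (hs : MemLp s 2 (G : Measure Z)) (t : Fin d → ℝ) :
    scaledNorm (fisher G s) t ^ 2 = ∫ z, (t ⬝ᵥ s z) ^ 2 ∂(G : Measure Z) := by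
  rw [scaledNorm_fisher hs, Real.sq_sqrt (integral_nonneg fun z => sq_nonneg _)]

end Basics

section LogRatioApproximation

variable {d : ℕ} {Z : Type*} [MeasurableSpace Z]

lemma eLpNorm_two_le_ofReal_iff {μ : Measure Z} {f : Z → ℝ} {c : ℝ} (hc : 0 ≤ c) :
    eLpNorm f 2 μ ≤ ENNReal.ofReal c ↔
      ∫⁻ z, ENNReal.ofReal (f z ^ 2) ∂μ ≤ ENNReal.ofReal (c ^ 2) := by
  have e : ∀ z, ‖f z‖ₑ ^ (2 : ℝ) = ENNReal.ofReal (f z ^ 2) := fun z => by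
    rw [ENNReal.rpow_ofNat, Real.enorm_eq_ofReal_abs, ← ENNReal.ofReal_pow (abs_nonneg _), sq_abs]
  rw [eLpNorm_eq_lintegral_rpow_enorm_toReal two_ne_zero ENNReal.ofNat_ne_top]
  simp only [ENNReal.toReal_ofNat, e, one_div]
  rw [ENNReal.rpow_inv_le_iff two_pos, ENNReal.ofReal_pow hc, ENNReal.rpow_ofNat]

lemma holderTriple_two {q : ℝ} (hq : 2 ≤ q) :
    ENNReal.HolderTriple (ENNReal.ofReal q) (ENNReal.ofReal (2 * q) / ENNReal.ofReal (q - 2)) 2 := by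
  constructor
  rw [ENNReal.inv_div (Or.inl ENNReal.ofReal_ne_top)
    (Or.inr (by simpa using (by linarith : 0 < q))),
    ← ENNReal.ofReal_inv_of_pos (by linarith), ← ENNReal.ofReal_div_of_pos (by linarith),
    ← ENNReal.ofReal_add (by positivity) (div_nonneg (by linarith) (by linarith)),
    show (2 : ℝ≥0∞) = ENNReal.ofReal 2 by simp, ← ENNReal.ofReal_inv_of_pos two_pos]
  congr 1
  have : q ≠ 0 := by linarith
  field_simp
  ring

lemma eLpNorm_mul_two_le {μ : Measure Z} {f g : Z → ℝ} {q : ℝ} (hq : 2 ≤ q)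
    (hf : AEStronglyMeasurable f μ) (hg : AEStronglyMeasurable g μ) :
    eLpNorm (fun z => f z * g z) 2 μ ≤ eLpNorm f (ENNReal.ofReal q) μ *
      eLpNorm g (ENNReal.ofReal (2 * q) / ENNReal.ofReal (q - 2)) μ := by
  have := holderTriple_two hq
  generalize ENNReal.ofReal (2 * q) / ENNReal.ofReal (q - 2) = b at *
  generalize ENNReal.ofReal q = a at *
  have h := eLpNorm_smul_le_mul_eLpNorm (p := a) (q := b) (r := 2) (𝕜 := ℝ) (E := ℝ) hg hf
  exact h

lemma eLpNorm_two_le_conj {μ : Measure Z} [IsProbabilityMeasure μ] {g : Z → ℝ} {q : ℝ}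
    (hq : 2 ≤ q) (hg : AEStronglyMeasurable g μ) :
    eLpNorm g 2 μ ≤ eLpNorm g (ENNReal.ofReal (2 * q) / ENNReal.ofReal (q - 2)) μ := by
  refine eLpNorm_le_eLpNorm_of_exponent_le ?_ hg
  have := (holderTriple_two hq).inv_add_inv_eq_inv
  rw [← ENNReal.inv_le_inv, ← this]
  exact le_add_self

variable {M : Model d Z} {𝒢 : Set (ProbabilityMeasure Z)}
  {θ : ProbabilityMeasure Z → Fin d → ℝ} {s : ProbabilityMeasure Z → Z → Fin d → ℝ}
  {V : ProbabilityMeasure Z → Matrix (Fin d) (Fin d) ℝ} {δ : ℕ → ℝ}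

lemma UniformLindeberg.exists_forall_le (hs : ∀ G ∈ 𝒢, MemLp (s G) 2 (G : Measure Z))
    (h : UniformLindeberg 𝒢 s) {ε : ℝ} (hε : 0 < ε) :
    ∃ κ > 0, ∀ G ∈ 𝒢, ∀ t, ∫⁻ z, ENNReal.ofReal
      ((t ⬝ᵥ s G z) ^ 2 / scaledNorm (fisher G (s G)) t ^ 2 *
        min 1 (|t ⬝ᵥ s G z| / (κ * scaledNorm (fisher G (s G)) t))) ∂(G : Measure Z)
      ≤ ENNReal.ofReal ε := by
  have h1 := h.2.eventually (gt_mem_nhds (ENNReal.ofReal_pos.2 hε))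
  obtain ⟨κ, hκ, hκ0⟩ := (h1.and (eventually_gt_atTop 0)).exists
  refine ⟨κ, hκ0, fun G hG t => ?_⟩
  rw [scaledNorm_fisher (hs G hG)]
  refine le_trans ?_ hκ.le
  exact le_iSup₂_of_le G hG (le_iSup_of_le t le_rfl)

/-- The tail part of a direction of the score is negligible in `L²`, relative to its norm. -/
lemma UniformLindeberg.exists_forall_tail_le (hs : ∀ G ∈ 𝒢, MemLp (s G) 2 (G : Measure Z))
    (h : UniformLindeberg 𝒢 s) {ε : ℝ} (hε : 0 < ε) :
    ∃ κ > 0, ∀ G ∈ 𝒢, ∀ t, 0 < scaledNorm (fisher G (s G)) t →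
      eLpNorm (fun z => {x : ℝ | κ * scaledNorm (fisher G (s G)) t < |x|}.indicator
        (fun x => |x|) (t ⬝ᵥ s G z)) 2 (G : Measure Z)
      ≤ ENNReal.ofReal (ε * scaledNorm (fisher G (s G)) t) := by
  obtain ⟨κ, hκ, hb⟩ := h.exists_forall_le hs (show 0 < ε ^ 2 by positivity)
  refine ⟨κ, hκ, fun G hG t ht => ?_⟩
  set σ := scaledNorm (fisher G (s G)) t with hσ
  rw [eLpNorm_two_le_ofReal_iff (by positivity)]
  set F : Z → ℝ := fun z =>
    (t ⬝ᵥ s G z) ^ 2 / σ ^ 2 * min 1 (|t ⬝ᵥ s G z| / (κ * σ)) with hF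
  calc _ ≤ ∫⁻ z, ENNReal.ofReal (σ ^ 2) * ENNReal.ofReal (F z) ∂(G : Measure Z) := by
        refine lintegral_mono fun z => ?_
        rw [← ENNReal.ofReal_mul (by positivity)]
        refine ENNReal.ofReal_le_ofReal ?_
        by_cases hz : κ * σ < |t ⬝ᵥ s G z|
        · simp only [hF]
          rw [indicator_of_mem (show t ⬝ᵥ s G z ∈ {x : ℝ | κ * σ < |x|} from hz),
            min_eq_left ((one_le_div (by positivity)).2 hz.le), sq_abs]
          refine le_of_eq ?_
          field_simp
        · rw [indicator_of_notMem (show t ⬝ᵥ s G z ∉ {x : ℝ | κ * σ < |x|} from hz)]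
          rw [zero_pow two_ne_zero]
          positivity
    _ = ENNReal.ofReal (σ ^ 2) * ∫⁻ z, ENNReal.ofReal (F z) ∂(G : Measure Z) :=
        lintegral_const_mul' _ _ ENNReal.ofReal_ne_top
    _ ≤ ENNReal.ofReal (σ ^ 2) * ENNReal.ofReal (ε ^ 2) := by gcongr; exact hb G hG t
    _ = _ := by rw [← ENNReal.ofReal_mul (by positivity)]; congr 1; ring

/-- Le Cam's expansion of the log-likelihood ratio in `L²(G)`, uniformly over `G ∈ 𝒢`. -/
lemma exists_radius_logRatio_approx (hθ : ∀ G ∈ 𝒢, θ G ∈ M.Θ) (hδ_pos : ∀ n, 1 ≤ n → 0 < δ n)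
    (hA1 : QMD M 𝒢 θ s δ) (hA4 : MomentConditions M 𝒢 θ s δ) (hA5 : UniformLindeberg 𝒢 s)
    {ε : ℝ} (hε : 0 < ε) :
    ∃ ρ > 0, ∀ G ∈ 𝒢, ∀ h, 0 < scaledNorm (fisher G (s G)) h →
      scaledNorm (fisher G (s G)) h ≤ ρ → θ G + h ∈ M.Θ ∧
      (∀ᵐ z ∂(G : Measure Z), 0 < M.p (θ G + h) z) ∧
      eLpNorm (M.sqrtRemainder (θ G) h (s G)) 2 (G : Measure Z)
        ≤ ENNReal.ofReal (ε * scaledNorm (fisher G (s G)) h) ∧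
      eLpNorm (fun z => M.logRatio (θ G + h) (θ G) z - h ⬝ᵥ s G z) 2 (G : Measure Z)
        ≤ ENNReal.ofReal (ε * scaledNorm (fisher G (s G)) h) := by
  obtain ⟨hs, φ, -, hφ, hφ'⟩ := hA1
  obtain ⟨q, hq, L, ν, -, hν, hν'⟩ := hA4
  set e := ε / 18 with he
  have he0 : 0 < e := by positivity
  obtain ⟨κ, hκ, hind⟩ := hA5.exists_forall_tail_le (fun G hG => (hs G hG).1) he0
  set e' := min e (e / κ) with he'
  have he'0 : 0 < e' := lt_min he0 (by positivity)
  obtain ⟨N, hN1, hN2, hN3⟩ := ((hφ' (e ^ 2) (by positivity)).and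
    ((hν' e' he'0).and (eventually_ge_atTop 1))).exists
  set ρ := δ N with hρ
  have hρ0 : 0 < ρ := hδ_pos N hN3
  refine ⟨ρ / 16, by positivity, fun G hG h hr0 hr => ?_⟩
  set r := scaledNorm (fisher G (s G)) h with hrdef
  have hrρ : r ∈ Ioc 0 ρ := ⟨hr0, by linarith⟩
  have hmem := (hφ G hG N hN3 r hrρ h le_rfl).1
  have hsm := (hs G hG).1.1
  set m := ρ / r with hm
  have hm16 : 16 ≤ m := by rw [hm, le_div_iff₀ hr0]; linarith
  have hm0 : 0 < m := by linarith
  have hmr : m * r = ρ := by rw [hm]; field_simp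
  have hnorm' : scaledNorm (fisher G (s G)) (m • h) ≤ ρ := by
    rw [scaledNorm_smul, abs_of_pos hm0, ← hrdef, hmr]
  have hρρ : ρ ∈ Ioc 0 ρ := ⟨hρ0, le_rfl⟩
  have hmem' := (hφ G hG N hN3 ρ hρρ (m • h) hnorm').1
  obtain ⟨hRq, hpos, hX⟩ := hν G hG N hN3 r hrρ h le_rfl hmem
  obtain ⟨hRq', -, -⟩ := hν G hG N hN3 ρ hρρ (m • h) hnorm' hmem'
  have hνb := hN2 G hG r hrρ
  set R := M.sqrtRemainder (θ G) h (s G) with hR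
  set R' := M.sqrtRemainder (θ G) (m • h) (s G) with hR'
  set X := M.logRatio (θ G + h) (θ G) with hXdef
  have mR : AEStronglyMeasurable R (G : Measure Z) :=
    M.aestronglyMeasurable_sqrtRemainder (hθ G hG) hmem hsm
  have mR' : AEStronglyMeasurable R' (G : Measure Z) :=
    M.aestronglyMeasurable_sqrtRemainder (hθ G hG) hmem' hsm
  have mX : AEStronglyMeasurable X (G : Measure Z) :=
    (M.measurable_logRatio (hθ G hG) hmem).aestronglyMeasurable
  have mg := dotProduct_aestronglyMeasurable hsm h
  have bR : eLpNorm R 2 (G : Measure Z) ≤ ENNReal.ofReal (e * r) := by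
    rw [eLpNorm_two_le_ofReal_iff (by positivity)]
    refine (hφ G hG N hN3 r hrρ h le_rfl).2.trans (ENNReal.ofReal_le_ofReal ?_)
    rw [mul_pow]; exact hN1 G hG r hrρ
  have hLe : max (L N G) 1 * ν G r ≤ e := hνb.trans (min_le_left _ _)
  have hM1 : 0 ≤ max (L N G) 1 := zero_le_one.trans (le_max_right _ _)
  have bRX : eLpNorm (fun z => R z * X z) 2 (G : Measure Z) ≤ ENNReal.ofReal (e * r) := by
    refine (eLpNorm_mul_two_le hq mR mX).trans ?_
    calc _ ≤ ENNReal.ofReal (max (L N G) 1 * r) * ENNReal.ofReal (ν G r) := by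
          gcongr
          refine hRq.trans (ENNReal.ofReal_le_ofReal ?_)
          gcongr; exact le_max_left _ _
      _ = ENNReal.ofReal (max (L N G) 1 * ν G r * r) := by
          rw [← ENNReal.ofReal_mul (by positivity)]; congr 1; ring
      _ ≤ _ := ENNReal.ofReal_le_ofReal (by gcongr)
  have bRX' : eLpNorm (fun z => R' z * X z) 2 (G : Measure Z) ≤ ENNReal.ofReal (e * ρ) := by
    refine (eLpNorm_mul_two_le hq mR' mX).trans ?_
    calc _ ≤ ENNReal.ofReal (max (L N G) 1 * ρ) * ENNReal.ofReal (ν G r) := by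
          gcongr
          refine hRq'.trans (ENNReal.ofReal_le_ofReal ?_)
          gcongr; exact le_max_left _ _
      _ = ENNReal.ofReal (max (L N G) 1 * ν G r * ρ) := by
          rw [← ENNReal.ofReal_mul (by positivity)]; congr 1; ring
      _ ≤ _ := ENNReal.ofReal_le_ofReal (by gcongr)
  have bX : eLpNorm X 2 (G : Measure Z) ≤ ENNReal.ofReal (e / κ) := by
    refine (eLpNorm_two_le_conj hq mX).trans (hX.trans ?_)
    rcases le_total (ν G r) 0 with h0 | h0
    · rw [ENNReal.ofReal_of_nonpos h0]; exact zero_le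
    · refine ENNReal.ofReal_le_ofReal (le_trans ?_ (hνb.trans (min_le_right _ _)))
      exact le_mul_of_one_le_left h0 (le_max_right _ _)
  have bI := hind G hG h hr0
  rw [← hrdef] at bI
  refine ⟨hmem, hpos, bR.trans (ENNReal.ofReal_le_ofReal (by gcongr; linarith)), ?_⟩
  set f1 : Z → ℝ := fun z => 4 * R z
  set f2 : Z → ℝ := fun z => 4 * (R z * X z)
  set f3 : Z → ℝ := fun z => 8 / m * (R' z * X z)
  set f4 : Z → ℝ := fun z => κ * r * X z
  set f5 : Z → ℝ := fun z => {x : ℝ | κ * r < |x|}.indicator (fun x => |x|) (h ⬝ᵥ s G z)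
  have hpt : ∀ᵐ z ∂(G : Measure Z), ‖X z - h ⬝ᵥ s G z‖ ≤
      ‖f1 z‖ + ‖f2 z‖ + ‖f3 z‖ + ‖f4 z‖ + ‖f5 z‖ := by
    filter_upwards [(hs G hG).2, hpos] with z h0 h1
    obtain ⟨hW, hXe⟩ := M.logRatio_eq (s G) h0 h1
    have h2 := M.neg_one_le_sqrtRemainder (θ G) (m • h) (s G) z
    rw [smul_dotProduct, smul_eq_mul] at h2
    have := abs_two_mul_log_sub_le hW hm16 h2 (show 0 ≤ κ * r by positivity)
    rw [← hXe] at this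
    simp only [Real.norm_eq_abs]
    refine this.trans (le_of_eq ?_)
    simp only [f1, f2, f3, f4, f5, abs_mul, abs_of_pos (show (0 : ℝ) < 4 by norm_num),
      abs_of_pos (show 0 < 8 / m by positivity), abs_of_pos hκ, abs_of_pos hr0]
    rw [abs_of_nonneg (indicator_nonneg (fun x _ => abs_nonneg x) (h ⬝ᵥ s G z))]
  have m1 : AEStronglyMeasurable f1 (G : Measure Z) := mR.const_mul _
  have m2 : AEStronglyMeasurable f2 (G : Measure Z) := (mR.mul mX).const_mul _
  have m3 : AEStronglyMeasurable f3 (G : Measure Z) := (mR'.mul mX).const_mul _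
  have m4 : AEStronglyMeasurable f4 (G : Measure Z) := mX.const_mul _
  have m5 : AEStronglyMeasurable f5 (G : Measure Z) := by
    have : Measurable ({x : ℝ | κ * r < |x|}.indicator fun x => |x|) :=
      measurable_norm.indicator (measurableSet_lt measurable_const measurable_norm)
    exact (this.comp_aemeasurable mg.aemeasurable).aestronglyMeasurable
  have cm : ∀ (c : ℝ) (f : Z → ℝ) (b : ℝ), 0 ≤ c →
      eLpNorm f 2 (G : Measure Z) ≤ ENNReal.ofReal b →
      eLpNorm (fun z => c * f z) 2 (G : Measure Z) ≤ ENNReal.ofReal (c * b) := by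
    intro c f b hc hb
    have : eLpNorm (fun z => c * f z) 2 (G : Measure Z) = ‖c‖ₑ * eLpNorm f 2 (G : Measure Z) :=
      eLpNorm_const_smul c f 2 (G : Measure Z)
    rw [this, Real.enorm_eq_ofReal hc, ENNReal.ofReal_mul hc]
    gcongr
  calc _ ≤ eLpNorm (fun z => ‖f1 z‖ + ‖f2 z‖ + ‖f3 z‖ + ‖f4 z‖ + ‖f5 z‖) 2 (G : Measure Z) :=
        eLpNorm_mono_ae_real hpt
    _ ≤ eLpNorm (fun z => ‖f1 z‖) 2 (G : Measure Z) + eLpNorm (fun z => ‖f2 z‖) 2 (G : Measure Z)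
        + eLpNorm (fun z => ‖f3 z‖) 2 (G : Measure Z) + eLpNorm (fun z => ‖f4 z‖) 2 (G : Measure Z)
        + eLpNorm (fun z => ‖f5 z‖) 2 (G : Measure Z) := by
        refine (eLpNorm_add_le (((m1.norm.add m2.norm).add m3.norm).add m4.norm) m5.norm
          one_le_two).trans ?_
        gcongr
        refine (eLpNorm_add_le ((m1.norm.add m2.norm).add m3.norm) m4.norm one_le_two).trans ?_
        gcongr
        refine (eLpNorm_add_le (m1.norm.add m2.norm) m3.norm one_le_two).trans ?_
        gcongr
        exact eLpNorm_add_le m1.norm m2.norm one_le_two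
    _ ≤ ENNReal.ofReal (4 * (e * r)) + ENNReal.ofReal (4 * (e * r))
        + ENNReal.ofReal (8 / m * (e * ρ)) + ENNReal.ofReal (κ * r * (e / κ))
        + ENNReal.ofReal (e * r) := by
        simp only [eLpNorm_norm]
        gcongr
        · exact cm _ _ _ (by norm_num) bR
        · exact cm _ _ _ (by norm_num) bRX
        · exact cm _ _ _ (by positivity) bRX'
        · exact cm _ _ _ (by positivity) bX
    _ = ENNReal.ofReal (ε * r) := by
        rw [← ENNReal.ofReal_add (by positivity) (by positivity),
          ← ENNReal.ofReal_add (by positivity) (by positivity),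
          ← ENNReal.ofReal_add (by positivity) (by positivity),
          ← ENNReal.ofReal_add (by positivity) (by positivity)]
        congr 1
        rw [← hmr, he]
        field_simp
        ring

end LogRatioApproximation

section FixedDirection

variable {d : ℕ} {Z : Type*} [MeasurableSpace Z]

lemma Model.extLogRatio_eq_coe (M : Model d Z) {θ θ' : Fin d → ℝ} {z : Z}
    (h0 : 0 < M.p θ z) (h1 : 0 < M.p θ' z) :
    M.extLogRatio θ' θ z = (M.logRatio θ' θ z : EReal) := by
  rw [Model.extLogRatio, ← ENNReal.ofReal_div_of_pos h0, ENNReal.log_ofReal_of_pos (div_pos h1 h0),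
    Model.logRatio]

lemma sum_coe_ereal {ι : Type*} (t : Finset ι) (f : ι → ℝ) :
    ∑ i ∈ t, (f i : EReal) = ((∑ i ∈ t, f i : ℝ) : EReal) := by
  classical
  induction t using Finset.induction_on with
  | empty => simp
  | insert i t hi ih => rw [Finset.sum_insert hi, Finset.sum_insert hi, ih, EReal.coe_add]

lemma ae_pi_forall {μ : Measure Z} [IsProbabilityMeasure μ] {n : ℕ} {P : Z → Prop}
    (h : ∀ᵐ z ∂μ, P z) : ∀ᵐ z ∂(Measure.pi fun _ : Fin n => μ), ∀ i, P (z i) :=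
  ae_all_iff.2 fun i => (Measure.quasiMeasurePreserving_eval (fun _ : Fin n => μ) i).ae h

lemma universalCI_ae_iff (M : Model d Z) {G : ProbabilityMeasure Z} {θ₀ θ₁ : Fin d → ℝ}
    (hθ : θ₀ ∈ M.Θ) (h0 : ∀ᵐ z ∂(G : Measure Z), 0 < M.p θ₀ z)
    (h1 : ∀ᵐ z ∂(G : Measure Z), 0 < M.p θ₁ z) (α : ℝ) (n : ℕ) :
    ∀ᵐ z ∂(Measure.pi fun _ : Fin n => (G : Measure Z)),
      (θ₀ ∈ universalCI M α θ₁ z ↔ ∑ i, M.logRatio θ₁ θ₀ (z i) ≤ Real.log (1 / α)) := by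
  filter_upwards [ae_pi_forall (n := n) h0, ae_pi_forall (n := n) h1] with z hz0 hz1
  have : ∑ i, M.extLogRatio θ₁ θ₀ (z i) = ((∑ i, M.logRatio θ₁ θ₀ (z i) : ℝ) : EReal) := by
    rw [← sum_coe_ereal]
    exact Finset.sum_congr rfl fun i _ => M.extLogRatio_eq_coe (hz0 i) (hz1 i)
  simp only [universalCI, mem_ofPred_eq, this, EReal.coe_le_coe_iff, hθ, true_and]

/-- Chebyshev's inequality for the replacement of the summands `X` by `a f`. -/
lemma measure_sum_le_ge {μ : Measure Z} [IsProbabilityMeasure μ] {X f : Z → ℝ} {a τ η c B : ℝ}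
    {n : ℕ} (hn : 1 ≤ n) (ha : 0 < a) (hτ : 0 ≤ τ) (hη : 0 < η)
    (hX : AEStronglyMeasurable X μ)
    (hf : MemLp f 2 μ) (hf0 : ∫ z, f z ∂μ = 0)
    (hD : eLpNorm (fun z => X z - a * f z) 2 μ ≤ ENNReal.ofReal (τ * a))
    (hB : n * ∫ z, X z ∂μ + √n * a * (c + η) ≤ B) :
    (Measure.pi fun _ : Fin n => μ).real {z | (√n)⁻¹ * ∑ i, f (z i) ≤ c} - (τ / η) ^ 2 ≤
      (Measure.pi fun _ : Fin n => μ).real {z | ∑ i, X (z i) ≤ B} := by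
  set D : Z → ℝ := fun z => X z - a * f z with hDdef
  set π := Measure.pi fun _ : Fin n => μ with hπ
  have hn0 : (0 : ℝ) < n := by exact_mod_cast hn
  have hsn : 0 < √(n : ℝ) := Real.sqrt_pos.2 hn0
  have mD : MemLp D 2 μ := ⟨hX.sub (hf.1.const_mul a), hD.trans_lt ENNReal.ofReal_lt_top⟩
  have iD := mD.integrable one_le_two
  have iaf : Integrable (fun z => a * f z) μ := (hf.integrable one_le_two).const_mul a
  have eD : ∫ z, D z ∂μ = ∫ z, X z ∂μ := by
    have hX' : ∀ z, X z = D z + a * f z := fun z => by rw [hDdef]; ring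
    simp_rw [hX']
    rw [integral_add iD iaf, integral_const_mul, hf0]; simp
  have vD : Var[D; μ] ≤ (τ * a) ^ 2 := by
    refine (variance_le_expectation_sq mD.1).trans ?_
    have h1 := (eLpNorm_two_le_ofReal_iff (by positivity)).1 hD
    rw [← ofReal_integral_eq_lintegral_ofReal mD.integrable_sq (ae_of_all _ fun z => sq_nonneg _)]
      at h1
    exact (ENNReal.ofReal_le_ofReal_iff (by positivity)).1 h1
  set S : (Fin n → Z) → ℝ := ∑ i, fun z => D (z i) with hS
  have mS : MemLp S 2 π := memLp_finsetSum' _ fun i _ =>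
    mD.comp_measurePreserving (measurePreserving_eval (fun _ : Fin n => μ) i)
  have vS : Var[S; π] ≤ n * (τ * a) ^ 2 := by
    rw [hS, hπ, variance_sum_pi (μ := fun _ : Fin n => μ) (X := fun _ => D) fun _ => mD]
    simpa using mul_le_mul_of_nonneg_left vD hn0.le
  have eS : π[S] = n * ∫ z, X z ∂μ := by
    rw [hS]
    simp only [Finset.sum_apply]
    have iDi : ∀ i, Integrable (fun z : Fin n → Z => D (z i)) π := fun i =>
      (measurePreserving_eval (fun _ : Fin n => μ) i).integrable_comp_of_integrable iD
    rw [integral_finsetSum _ fun i _ => iDi i]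
    have : ∀ i, ∫ z, D (z i) ∂π = ∫ z, X z ∂μ := fun i => by
      rw [← eD]
      exact (integral_comp_eval (μ := fun _ : Fin n => μ) (i := i) mD.1)
    simp [this]
  have hcheb := meas_ge_le_variance_div_sq mS (show 0 < √n * a * η by positivity)
  have hcheb' : π.real {z | √n * a * η ≤ |S z - π[S]|} ≤ (τ / η) ^ 2 := by
    refine ENNReal.toReal_le_of_le_ofReal (by positivity) (hcheb.trans
      (ENNReal.ofReal_le_ofReal ?_))
    rw [div_le_iff₀ (by positivity)]
    refine vS.trans (le_of_eq ?_)
    rw [mul_pow, mul_pow, mul_pow, Real.sq_sqrt hn0.le]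
    field_simp
  have hsub : {z | (√n)⁻¹ * ∑ i, f (z i) ≤ c} ⊆
      {z | ∑ i, X (z i) ≤ B} ∪ {z | √n * a * η ≤ |S z - π[S]|} := by
    intro z hz
    by_contra hcon
    simp only [mem_union, mem_ofPred_eq, not_or, not_le] at hcon hz
    obtain ⟨h1, h2⟩ := hcon
    have h3 : ∑ i, X (z i) = S z + a * ∑ i, f (z i) := by
      rw [hS, Finset.sum_apply, Finset.mul_sum, ← Finset.sum_add_distrib]
      exact Finset.sum_congr rfl fun i _ => by rw [hDdef]; ring
    have h4 : ∑ i, f (z i) ≤ √n * c := by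
      rwa [inv_mul_le_iff₀ hsn] at hz
    have h5 := (abs_lt.1 h2).2
    have h6 : a * ∑ i, f (z i) ≤ a * (√n * c) := by gcongr
    rw [eS] at h5
    nlinarith
  have := (measureReal_mono (μ := π) hsub (measure_ne_top _ _)).trans (measureReal_union_le _ _)
  linarith

lemma integral_dotProduct_eq_zero {μ : Measure Z} [IsFiniteMeasure μ] {s : Z → Fin d → ℝ}
    (hs : MemLp s 2 μ) (h0 : ∫ z, s z ∂μ = 0) (t : Fin d → ℝ) : ∫ z, t ⬝ᵥ s z ∂μ = 0 := by
  have hi : ∀ i, Integrable (fun z => s z i) μ := fun i => (MemLp.eval hs i).integrable one_le_two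
  simp only [dotProduct]
  rw [integral_finsetSum _ fun i _ => (hi i).const_mul _]
  refine Finset.sum_eq_zero fun i _ => ?_
  rw [integral_const_mul, ← eval_integral hi, h0]; simp

variable {M : Model d Z} {𝒢 : Set (ProbabilityMeasure Z)}
  {θ : ProbabilityMeasure Z → Fin d → ℝ} {s : ProbabilityMeasure Z → Z → Fin d → ℝ}
  {V : ProbabilityMeasure Z → Matrix (Fin d) (Fin d) ℝ} {δ : ℕ → ℝ}

/-- Uniform central limit theorem for the standardized directions of the score. -/
lemma eventually_forall_score_clt (hs : ∀ G ∈ 𝒢, MemLp (s G) 2 (G : Measure Z))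
    (hA5 : UniformLindeberg 𝒢 s) (c : ℝ) {η : ℝ} (hη : 0 < η) :
    ∀ᶠ n : ℕ in atTop, ∀ G ∈ 𝒢, ∀ t, 0 < scaledNorm (fisher G (s G)) t → Φ c - η ≤
      (Measure.pi fun _ : Fin n => (G : Measure Z)).real
        {z | (√n)⁻¹ * ∑ i, (t ⬝ᵥ s G (z i)) / scaledNorm (fisher G (s G)) t ≤ c} := by
  have mf : ∀ G ∈ 𝒢, ∀ t, MemLp (fun z => (t ⬝ᵥ s G z) / scaledNorm (fisher G (s G)) t) 2
      (G : Measure Z) := fun G hG t => by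
    simpa only [div_eq_inv_mul] using (memLp_dotProduct (hs G hG) t).const_mul _
  set A : Set (ProbabilityMeasure ℝ) := {μ | ∃ G ∈ 𝒢, ∃ t, 0 < scaledNorm (fisher G (s G)) t ∧
    (μ : Measure ℝ) = (G : Measure Z).map
      (fun z => (t ⬝ᵥ s G z) / scaledNorm (fisher G (s G)) t)} with hA
  have hclt := eventually_forall_measure_Iic_of_lindeberg A ?_ ?_ ?_ ?_ c hη
  · filter_upwards [hclt] with n hn G hG t ht
    have am := (mf G hG t).1.aemeasurable
    have hp : IsProbabilityMeasure ((G : Measure Z).map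
      (fun z => (t ⬝ᵥ s G z) / scaledNorm (fisher G (s G)) t)) :=
        Measure.isProbabilityMeasure_map am
    have h1 := hn ⟨_, hp⟩ ⟨G, hG, t, ht, rfl⟩
    refine h1.trans (le_of_eq ?_)
    have h2 := Measure.pi_map_pi (μ := fun _ : Fin n => (G : Measure Z)) (fun _ : Fin n => am)
    change (Measure.pi fun _ : Fin n => (G : Measure Z).map
      (fun z => (t ⬝ᵥ s G z) / scaledNorm (fisher G (s G)) t)).real _ = _
    rw [← h2, map_measureReal_apply_of_aemeasurable _ _]
    · rfl
    · exact aemeasurable_pi_lambda _ fun i =>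
        am.comp_quasiMeasurePreserving (Measure.quasiMeasurePreserving_eval _ i)
    · exact measurableSet_le (by fun_prop) measurable_const
  · rintro μ ⟨G, hG, t, ht, hμ⟩
    have am := (mf G hG t).1.aemeasurable
    rw [hμ, integrable_map_measure (by fun_prop) am]
    exact (mf G hG t).integrable_sq
  · rintro μ ⟨G, hG, t, ht, hμ⟩
    have am := (mf G hG t).1.aemeasurable
    rw [hμ, integral_map am (by fun_prop), integral_div]
    rw [integral_dotProduct_eq_zero (hs G hG) (hA5.1 G hG), zero_div]
  · rintro μ ⟨G, hG, t, ht, hμ⟩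
    have am := (mf G hG t).1.aemeasurable
    rw [hμ, integral_map am (by fun_prop)]
    simp only [div_pow]
    rw [integral_div, ← scaledNorm_fisher_sq (hs G hG)]
    exact div_self (by positivity)
  · intro ε hε
    obtain ⟨κ, hκ, hb⟩ := hA5.exists_forall_le hs hε
    refine ⟨κ, hκ, ?_⟩
    rintro μ ⟨G, hG, t, ht, hμ⟩
    have am := (mf G hG t).1.aemeasurable
    rw [hμ, integral_map am (by fun_prop)]
    rw [integral_eq_lintegral_of_nonneg_ae (ae_of_all _ fun z => by positivity)]
    · refine ENNReal.toReal_le_of_le_ofReal hε.le (le_trans (le_of_eq ?_) (hb G hG t))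
      refine lintegral_congr fun z => ?_
      rw [div_pow, abs_div, abs_of_pos ht, div_div, mul_comm κ]
    · exact ((by fun_prop : Measurable fun x : ℝ => x ^ 2 * min 1 (|x| / κ)).comp_aemeasurable
        am).aestronglyMeasurable

end FixedDirection

section Coverage

variable {d : ℕ} {Z : Type*} [MeasurableSpace Z]

lemma scaledNorm_sq_of_posDef {A : Matrix (Fin d) (Fin d) ℝ} (hA : A.PosDef) (h : Fin d → ℝ) :
    scaledNorm A h ^ 2 = h ⬝ᵥ (A *ᵥ h) :=
  Real.sq_sqrt (by simpa using hA.posSemidef.dotProduct_mulVec_nonneg h)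

lemma scaledNorm_pos_of_posDef {A : Matrix (Fin d) (Fin d) ℝ} (hA : A.PosDef) {h : Fin d → ℝ}
    (hh : h ≠ 0) : 0 < scaledNorm A h :=
  Real.sqrt_pos.2 (by simpa using hA.dotProduct_mulVec_pos hh)

lemma IsModulus.exists_lt {ν : ℝ → ℝ} (hν : IsModulus ν) {ε δ : ℝ} (hε : 0 < ε)
    (hδ : 0 < δ) : ∃ r ∈ Ioc 0 δ, ν r < ε := by
  obtain ⟨h0, -, hc⟩ := hν
  have h1 : ∀ᶠ r in 𝓝[>] (0 : ℝ), ν r < ε :=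
    (hc.mono Ioi_subset_Ici_self).eventually (gt_mem_nhds (by rwa [h0]))
  obtain ⟨r, hr, hr'⟩ := (h1.and (Ioc_mem_nhdsGT hδ)).exists
  exact ⟨r, hr', hr⟩

variable {M : Model d Z} {𝒢 : Set (ProbabilityMeasure Z)}
  {θ : ProbabilityMeasure Z → Fin d → ℝ} {s : ProbabilityMeasure Z → Z → Fin d → ℝ}
  {V : ProbabilityMeasure Z → Matrix (Fin d) (Fin d) ℝ} {δ : ℕ → ℝ}

/-- The information matrix is positive definite: along a direction in its kernel the likelihood
would be constant, against the quadratic expansion of the Kullback–Leibler divergence. -/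
lemma scaledNorm_fisher_pos (hθ : ∀ G ∈ 𝒢, θ G ∈ M.Θ) (hδ_pos : ∀ n, 1 ≤ n → 0 < δ n)
    (hA1 : QMD M 𝒢 θ s δ) (hA2 : QuadraticExpansion M 𝒢 θ V δ) (hA4 : MomentConditions M 𝒢 θ s δ)
    {G : ProbabilityMeasure Z} (hG : G ∈ 𝒢) {h : Fin d → ℝ} (hh : h ≠ 0) :
    0 < scaledNorm (fisher G (s G)) h := by
  obtain ⟨-, φ, -, hφ, -⟩ := hA1
  obtain ⟨hV, ω, -, hω, hω'⟩ := hA2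
  obtain ⟨q, hq, L, ν, hνm, hν, -⟩ := hA4
  by_contra! hle
  have hI := le_antisymm hle (scaledNorm_nonneg _ _)
  obtain ⟨n, hn, hn1⟩ := ((hω' (1 / 4) (by norm_num)).and (eventually_ge_atTop 1)).exists
  have hv := scaledNorm_pos_of_posDef (hV G hG) hh
  have hδn := hδ_pos n hn1
  set c := δ n / scaledNorm (V G) h with hc
  have hc0 : 0 < c := by positivity
  have hVc : scaledNorm (V G) (c • h) = δ n := by
    rw [scaledNorm_smul, abs_of_pos hc0, hc]; field_simp
  have hIc : scaledNorm (fisher G (s G)) (c • h) = 0 := by rw [scaledNorm_smul, hI, mul_zero]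
  have hmem := (hφ G hG n hn1 (δ n) ⟨hδn, le_rfl⟩ (c • h) (by rw [hIc]; exact hδn.le)).1
  have mX := (M.measurable_logRatio (hθ G hG) hmem).aestronglyMeasurable (μ := (G : Measure Z))
  have hX0 : eLpNorm (M.logRatio (θ G + c • h) (θ G)) 2 (G : Measure Z) = 0 := by
    refine le_antisymm (ENNReal.le_of_forall_pos_le_add fun ε hε _ => ?_) (zero_le)
    obtain ⟨r, hr, hr'⟩ := IsModulus.exists_lt (hνm G hG) (ε := ε)
      (by exact_mod_cast hε) hδn
    have := (hν G hG n hn1 r hr (c • h) (by rw [hIc]; exact hr.1.le) hmem).2.2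
    rw [zero_add, ← ENNReal.ofReal_coe_nnreal]
    exact (eLpNorm_two_le_conj hq mX).trans (this.trans (ENNReal.ofReal_le_ofReal hr'.le))
  rw [eLpNorm_eq_zero_iff mX two_ne_zero] at hX0
  have h2 := (hω G hG n hn1 (δ n) ⟨hδn, le_rfl⟩ (c • h) hVc.le hmem).2.2
  rw [integral_congr_ae hX0, ← scaledNorm_sq_of_posDef (hV G hG), hVc] at h2
  have h3 := hn G hG (δ n) ⟨hδn, le_rfl⟩
  simp only [Pi.zero_apply, integral_zero, zero_add] at h2
  rw [abs_of_nonneg (by positivity)] at h2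
  nlinarith [pow_pos hδn 2]

lemma sqrt_mul_mul_le_of_sq_le {B v a c κ x : ℝ} (hB : 0 ≤ B)
    (hκ : 0 ≤ κ) (hκ1 : κ ≤ 1) (hx : 0 ≤ x) (h : c ^ 2 * a ^ 2 ≤ 2 * B * v ^ 2) :
    √x * a * (κ * c) ≤ B + κ * (x * v ^ 2 / 2) := by
  have h1 : √x * a * c ≤ B + x * v ^ 2 / 2 := by
    refine abs_le_of_sq_le_sq' ?_ (by positivity) |>.2
    have : (√x * a * c) ^ 2 = x * (c ^ 2 * a ^ 2) := by
      rw [mul_pow, mul_pow, Real.sq_sqrt hx]; ring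
    rw [this]
    nlinarith [mul_le_mul_of_nonneg_left h hx, sq_nonneg (B - x * v ^ 2 / 2)]
  calc √x * a * (κ * c) = κ * (√x * a * c) := by ring
    _ ≤ κ * (B + x * v ^ 2 / 2) := by gcongr
    _ ≤ _ := by nlinarith

/-- Conditional coverage, given an initial estimate `θ_G + h` close to `θ_G`. -/
lemma eventually_forall_conditional_coverage_ge (hθ : ∀ G ∈ 𝒢, θ G ∈ M.Θ)
    (hδ_pos : ∀ n, 1 ≤ n → 0 < δ n) (hδ : Tendsto δ atTop (𝓝 0))
    (hA1 : QMD M 𝒢 θ s δ) (hA2 : QuadraticExpansion M 𝒢 θ V δ) (hA4 : MomentConditions M 𝒢 θ s δ)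
    (hA5 : UniformLindeberg 𝒢 s) {α : ℝ} (hα : α ∈ Ioo (0 : ℝ) 1) {c η : ℝ}
    (hη : 0 < η) :
    ∀ᶠ n in atTop, ∀ G ∈ 𝒢, ∀ h, θ G + h ∈ M.Θ →
      scaledNorm (fisher G (s G)) h ≤ δ n → scaledNorm (V G) h ≤ δ n →
      c ^ 2 * scaledNorm (fisher G (s G)) h ^ 2 ≤
        2 * Real.log (1 / α) * scaledNorm (V G) h ^ 2 →
      Φ c - η ≤ (Measure.pi fun _ : Fin n => (G : Measure Z)).real
        {z | θ G ∈ universalCI M α (θ G + h) z} := by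
  have hB : 0 < Real.log (1 / α) := Real.log_pos (by rw [lt_div_iff₀ hα.1]; linarith [hα.2])
  set B := Real.log (1 / α) with hBdef
  have hs : ∀ G ∈ 𝒢, MemLp (s G) 2 (G : Measure Z) := fun G hG => (hA1.1 G hG).1
  obtain ⟨ε, hε0, hε1, hεη, hεΦ⟩ : ∃ ε : ℝ, 0 < ε ∧ ε ≤ 1 / 2 ∧ ε ^ 2 + ε ≤ η / 2 ∧
      Φ c - η / 2 ≤ Φ ((1 - 2 * ε) * c - ε) := by
    have h1 : Tendsto (fun ε : ℝ => Φ ((1 - 2 * ε) * c - ε)) (𝓝 0) (𝓝 (Φ c)) := by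
      have : Continuous fun ε : ℝ => Φ ((1 - 2 * ε) * c - ε) := Φ_continuous.comp (by fun_prop)
      simpa using this.tendsto 0
    have h2 : Tendsto (fun ε : ℝ => ε ^ 2 + ε) (𝓝 0) (𝓝 0) := by
      have : Continuous fun ε : ℝ => ε ^ 2 + ε := by fun_prop
      simpa using this.tendsto 0
    have h3 := ((h1.eventually (lt_mem_nhds (show Φ c - η / 2 < Φ c by linarith))).and
      (h2.eventually (gt_mem_nhds (show 0 < η / 2 by linarith)))).filter_mono
        (nhdsWithin_le_nhds (s := Ioi 0))
    obtain ⟨ε, ⟨h4, h5⟩, h6⟩ :=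
      (h3.and (Ioc_mem_nhdsGT (show (0 : ℝ) < 1 / 2 by norm_num))).exists
    exact ⟨ε, h6.1, h6.2, h5.le, h4.le⟩
  obtain ⟨ρ, hρ, happ⟩ := exists_radius_logRatio_approx hθ hδ_pos hA1 hA4 hA5
    (show 0 < ε ^ 2 by positivity)
  have hclt := eventually_forall_score_clt hs hA5 ((1 - 2 * ε) * c - ε) hε0
  obtain ⟨hV, ω, -, hω, hω'⟩ := id hA2
  filter_upwards [hclt, hω' ε hε0, eventually_ge_atTop 1,
    hδ.eventually (gt_mem_nhds hρ)] with n hn1 hn2 hn3 hn4 G hG h hmem hI hVh hcond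
  rcases eq_or_ne h 0 with rfl | hh
  · have h1 : ∀ᵐ z ∂(Measure.pi fun _ : Fin n => (G : Measure Z)),
        θ G ∈ universalCI M α (θ G + 0) z := by
      filter_upwards [universalCI_ae_iff M (hθ G hG) (hA1.1 G hG).2
        (θ₁ := θ G + 0) (by simpa using (hA1.1 G hG).2) α n,
        ae_pi_forall (n := n) (hA1.1 G hG).2] with z hz hz0
      rw [hz]
      refine le_trans (le_of_eq ?_) hB.le
      refine Finset.sum_eq_zero fun i _ => ?_
      rw [Model.logRatio, add_zero, div_self (hz0 i).ne', Real.log_one]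
    have h2 : (Measure.pi fun _ : Fin n => (G : Measure Z)).real
        {z | θ G ∈ universalCI M α (θ G + 0) z} = 1 := by
      rw [measureReal_congr (eventuallyEq_univ.2 h1), probReal_univ]
    rw [h2]
    have := cdf_le_one (gaussianReal 0 1) c
    change Φ c ≤ 1 at this
    linarith
  · have ha := scaledNorm_fisher_pos hθ hδ_pos hA1 hA2 hA4 hG hh
    set a := scaledNorm (fisher G (s G)) h with hadef
    have hv := scaledNorm_pos_of_posDef (hV G hG) hh
    set v := scaledNorm (V G) h with hvdef
    obtain ⟨-, hpos, -, hD⟩ := happ G hG h ha (hI.trans hn4.le)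
    have hmean := (hω G hG n hn3 v ⟨hv, hVh⟩ h le_rfl hmem).2.2.trans (hn2 G hG v ⟨hv, hVh⟩)
    rw [← scaledNorm_sq_of_posDef (hV G hG), ← hvdef] at hmean
    have hmean' := (abs_le.1 hmean).2
    have hmf : MemLp (fun z => (h ⬝ᵥ s G z) / a) 2 (G : Measure Z) := by
      simpa only [div_eq_inv_mul] using (memLp_dotProduct (hs G hG) h).const_mul _
    have hf0 : ∫ z, (h ⬝ᵥ s G z) / a ∂(G : Measure Z) = 0 := by
      rw [integral_div, integral_dotProduct_eq_zero (hs G hG) (hA5.1 G hG), zero_div]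
    have hsum := measure_sum_le_ge (μ := (G : Measure Z)) (X := M.logRatio (θ G + h) (θ G))
      (f := fun z => (h ⬝ᵥ s G z) / a) (τ := ε ^ 2) (η := ε) (B := B)
      (c := (1 - 2 * ε) * c - ε) hn3 ha (by positivity) hε0
      (M.measurable_logRatio (hθ G hG) hmem).aestronglyMeasurable hmf hf0
      (by simpa only [mul_div_cancel₀ _ ha.ne'] using hD) ?_
    · have hcl := hn1 G hG h ha
      have heq : (Measure.pi fun _ : Fin n => (G : Measure Z)).real
          {z | θ G ∈ universalCI M α (θ G + h) z} =
          (Measure.pi fun _ : Fin n => (G : Measure Z)).real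
          {z | ∑ i, M.logRatio (θ G + h) (θ G) (z i) ≤ B} := by
        refine measureReal_congr ?_
        filter_upwards [universalCI_ae_iff M (hθ G hG) (hA1.1 G hG).2 hpos α n] with z hz
        exact propext hz
      rw [heq]
      have : (ε ^ 2 / ε) ^ 2 = ε ^ 2 := by field_simp
      rw [this] at hsum
      linarith
    · have h1 := sqrt_mul_mul_le_of_sq_le (κ := 1 - 2 * ε) (x := n) hB.le (by linarith)
        (by linarith) (Nat.cast_nonneg n) hcond
      have h2 : (n : ℝ) * ∫ z, M.logRatio (θ G + h) (θ G) z ∂(G : Measure Z) ≤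
          n * (ε * v ^ 2 - 1 / 2 * v ^ 2) := by gcongr; linarith
      have h3 : √(n : ℝ) * a * ((1 - 2 * ε) * c - ε + ε) = √n * a * ((1 - 2 * ε) * c) := by ring
      rw [h3]
      linarith

variable {k : ℕ → ℕ} {est : (n : ℕ) → (Fin (k n) → Z) → Fin d → ℝ}

lemma measurableSet_coverage (M : Model d Z) {θ₀ : Fin d → ℝ} (hθ : θ₀ ∈ M.Θ) {m n : ℕ}
    {T : (Fin m → Z) → Fin d → ℝ} (hT : Measurable T) (hT' : ∀ x, T x ∈ M.Θ) (α : ℝ) :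
    MeasurableSet {x : (Fin m → Z) × (Fin n → Z) | θ₀ ∈ universalCI M α (T x.1) x.2} := by
  simp only [universalCI, mem_ofPred_eq, hθ, true_and]
  refine measurableSet_le (Finset.measurable_sum _ fun i _ => ?_) measurable_const
  simp only [Model.extLogRatio]
  have h1 : Measurable fun x : (Fin m → Z) × (Fin n → Z) => M.p (T x.1) (x.2 i) := by
    have : Measurable fun x : (Fin m → Z) × (Fin n → Z) => ((⟨T x.1, hT' x.1⟩ : M.Θ), x.2 i) :=
      ((hT.comp measurable_fst).subtype_mk).prodMk ((measurable_pi_apply i).comp measurable_snd)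
    exact M.measurable_p.comp (g := fun x : M.Θ × Z => M.p x.1 x.2) this
  have h2 : Measurable fun x : (Fin m → Z) × (Fin n → Z) => M.p θ₀ (x.2 i) :=
    (M.measurable_density hθ).comp ((measurable_pi_apply i).comp measurable_snd)
  exact ENNReal.measurable_log.comp (h1.ennreal_ofReal.div h2.ennreal_ofReal)

/-- Uniform asymptotic lower bound on the coverage. -/
lemma eventually_forall_coverage_ge (hθ : ∀ G ∈ 𝒢, θ G ∈ M.Θ)
    (hδ_pos : ∀ n, 1 ≤ n → 0 < δ n) (hδ : Tendsto δ atTop (𝓝 0))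
    (hest_meas : ∀ n, Measurable (est n)) (hest : ∀ n x, est n x ∈ M.Θ)
    (hA1 : QMD M 𝒢 θ s δ) (hA2 : QuadraticExpansion M 𝒢 θ V δ)
    (hA3 : InitialConsistency 𝒢 θ s V δ k est) (hA4 : MomentConditions M 𝒢 θ s δ)
    (hA5 : UniformLindeberg 𝒢 s) {α : ℝ} (hα : α ∈ Ioo (0 : ℝ) 1) {c η : ℝ}
    (hη : 0 < η) :
    ∀ᶠ n in atTop, ∀ G ∈ 𝒢, (∀ h, c ^ 2 * scaledNorm (fisher G (s G)) h ^ 2 ≤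
        2 * Real.log (1 / α) * scaledNorm (V G) h ^ 2) →
      ENNReal.ofReal (Φ c - η) ≤ coverage M θ k est α n G := by
  have h3 := eventually_lt_of_limsup_lt (lt_of_eq_of_lt hA3
    (ENNReal.ofReal_pos.2 (show 0 < η / 2 by positivity)))
  filter_upwards [h3, eventually_forall_conditional_coverage_ge hθ hδ_pos hδ hA1 hA2 hA4 hA5 hα
    (show 0 < η / 2 by positivity)] with n hn1 hn2 G hG hcond
  rcases le_or_gt (Φ c - η) 0 with h0 | h0
  · rw [ENNReal.ofReal_of_nonpos h0]; exact zero_le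
  have htail : tailProb θ s V k est n G (δ n) ≤ ENNReal.ofReal (η / 2) :=
    (le_iSup₂_of_le G hG le_rfl).trans hn1.le
  set P := Measure.pi fun _ : Fin (k n) => (G : Measure Z)
  set Q := Measure.pi fun _ : Fin n => (G : Measure Z)
  set A : Set (Fin (k n) → Z) := {x | δ n < max (scaledNorm (fisher G (s G)) (est n x - θ G))
      (max (scaledNorm (V G) (est n x - θ G))
        (scaledNorm (V G) (est n x - θ G) ^ 2 /
          scaledNorm (fisher G (s G)) (est n x - θ G)))} with hA
  have mA : MeasurableSet A := by
    have hm : ∀ W : Matrix (Fin d) (Fin d) ℝ, Measurable fun x => scaledNorm W (est n x - θ G) := by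
      intro W
      have : Continuous fun h : Fin d → ℝ => scaledNorm W h := by
        unfold scaledNorm; fun_prop
      exact this.measurable.comp ((hest_meas n).sub_const _)
    exact measurableSet_lt measurable_const ((hm _).max ((hm _).max (((hm _).pow_const 2).div (hm _))))
  have hPA : P A ≤ ENNReal.ofReal (η / 2) := by
    have : tailProb θ s V k est n G (δ n) = (P.prod Q) (A ×ˢ univ) := by
      rw [tailProb, sampleLaw, prod_univ]; rfl
    rwa [this, Measure.prod_prod, measure_univ, mul_one] at htail
  have hPAc : ENNReal.ofReal (1 - η / 2) ≤ P Aᶜ := by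
    rw [prob_compl_eq_one_sub mA, ENNReal.ofReal_sub _ (by positivity), ENNReal.ofReal_one]
    exact tsub_le_tsub_left hPA _
  have hcovQ : ∀ x ∈ Aᶜ, ENNReal.ofReal (Φ c - η / 2) ≤
      Q {z | θ G ∈ universalCI M α (est n x) z} := by
    intro x hx
    simp only [hA, mem_compl_iff, mem_ofPred_eq, not_lt, max_le_iff] at hx
    have hx' : θ G + (est n x - θ G) = est n x := by abel
    have := hn2 G hG (est n x - θ G) (by rw [hx']; exact hest n x) hx.1 hx.2.1 (hcond _)
    rw [hx'] at this
    exact ENNReal.ofReal_le_of_le_toReal this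
  have hΦ1 : Φ c ≤ 1 := cdf_le_one _ _
  calc ENNReal.ofReal (Φ c - η) ≤ ENNReal.ofReal ((Φ c - η / 2) * (1 - η / 2)) := by
        refine ENNReal.ofReal_le_ofReal ?_
        nlinarith
    _ = ENNReal.ofReal (Φ c - η / 2) * ENNReal.ofReal (1 - η / 2) :=
        ENNReal.ofReal_mul (by linarith)
    _ ≤ ENNReal.ofReal (Φ c - η / 2) * P Aᶜ := by gcongr
    _ = ∫⁻ _ in Aᶜ, ENNReal.ofReal (Φ c - η / 2) ∂P := by rw [setLIntegral_const]
    _ ≤ ∫⁻ x in Aᶜ, Q {z | θ G ∈ universalCI M α (est n x) z} ∂P :=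
        setLIntegral_mono' mA.compl hcovQ
    _ ≤ ∫⁻ x, Q {z | θ G ∈ universalCI M α (est n x) z} ∂P := setLIntegral_le_lintegral _ _
    _ = coverage M θ k est α n G := by
        rw [coverage, sampleLaw, Measure.prod_apply
          (measurableSet_coverage M (hθ G hG) (hest_meas n) (hest n) α)]
        rfl

lemma coverage_toReal_eq (hest_meas : ∀ n, Measurable (est n)) (hest : ∀ n x, est n x ∈ M.Θ)
    {G : ProbabilityMeasure Z} (hθ : θ G ∈ M.Θ) (α : ℝ) (n : ℕ) :
    coverage M θ k est α n G = ENNReal.ofReal (1 - (miscoverage M θ k est α n G).toReal) := by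
  have hp : IsProbabilityMeasure (sampleLaw G (k n) n) := by unfold sampleLaw; infer_instance
  have hm := measurableSet_coverage M hθ (n := n) (hest_meas n) (hest n) α
  have e : miscoverage M θ k est α n G = 1 - coverage M θ k est α n G := by
    rw [coverage, ← prob_compl_eq_one_sub hm]; rfl
  have h1 : coverage M θ k est α n G ≤ 1 := prob_le_one
  have h2 : coverage M θ k est α n G ≠ ⊤ := ne_top_of_le_ne_top ENNReal.one_ne_top h1
  rw [e, ENNReal.toReal_sub_of_le h1 ENNReal.one_ne_top, ENNReal.toReal_one, sub_sub_cancel,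
    ENNReal.ofReal_toReal h2]

end Coverage

section CorrectSpecification

variable {d : ℕ} {Z : Type*} [MeasurableSpace Z]

lemma abs_sub_add_le_quadratic {g R X ε : ℝ} (hε : 0 < ε) (hW : -1 < g / 2 + R)
    (hX : X = 2 * Real.log (1 + (g / 2 + R))) :
    |X - ((1 + (g / 2 + R)) ^ 2 - 1) + g ^ 2 / 2| ≤
      ε * g ^ 2 + R ^ 2 / ε + 2 * R ^ 2 + (ε * (g ^ 2 / 2 + 2 * R ^ 2)
        + (2 * (X - g) ^ 2 + 8 * R ^ 2) / ε) / 2 := by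
  have young : ∀ x y : ℝ, 2 * (|x| * |y|) ≤ ε * x ^ 2 + y ^ 2 / ε := by
    intro x y
    have h : 0 ≤ (ε * |x| - |y|) ^ 2 / ε := by positivity
    have : (ε * |x| - |y|) ^ 2 / ε = ε * x ^ 2 + y ^ 2 / ε - 2 * (|x| * |y|) := by
      rw [← sq_abs x, ← sq_abs y]; field_simp; ring
    linarith
  set w := g / 2 + R with hw
  have h1 := abs_log_one_add_sub_add_le hW
  have e1 : X - ((1 + w) ^ 2 - 1) + g ^ 2 / 2 =
      2 * (Real.log (1 + w) - w + w ^ 2 / 2) + (-(2 * (g * R)) - 2 * R ^ 2) := by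
    rw [hX, hw]; ring
  have e2 : X - 2 * w = 2 * (Real.log (1 + w) - w) := by rw [hX]; ring
  have h2 : 2 * (|w| * |Real.log (1 + w) - w|) ≤
      (ε * (g ^ 2 / 2 + 2 * R ^ 2) + (2 * (X - g) ^ 2 + 8 * R ^ 2) / ε) / 2 := by
    have h3 := young w (X - 2 * w)
    have h4 : |X - 2 * w| = 2 * |Real.log (1 + w) - w| := by rw [e2, abs_mul]; simp
    have h5 : w ^ 2 ≤ g ^ 2 / 2 + 2 * R ^ 2 := by rw [hw]; nlinarith [sq_nonneg (g / 2 - R)]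
    have h6 : (X - 2 * w) ^ 2 ≤ 2 * (X - g) ^ 2 + 8 * R ^ 2 := by
      rw [hw]; nlinarith [sq_nonneg (X - g + 2 * R)]
    have h7 : ε * w ^ 2 + (X - 2 * w) ^ 2 / ε ≤
        ε * (g ^ 2 / 2 + 2 * R ^ 2) + (2 * (X - g) ^ 2 + 8 * R ^ 2) / ε := by gcongr
    rw [h4] at h3
    linarith
  have h8 := young g R
  rw [e1]
  refine (abs_add_le _ _).trans ?_
  have h9 : |2 * (Real.log (1 + w) - w + w ^ 2 / 2)| ≤ 2 * (|w| * |Real.log (1 + w) - w|) := by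
    rw [abs_mul, abs_two]; linarith
  have h10 : |-(2 * (g * R)) - 2 * R ^ 2| ≤ 2 * (|g| * |R|) + 2 * R ^ 2 := by
    refine (abs_sub _ _).trans ?_
    rw [abs_neg, abs_mul, abs_mul, abs_two, abs_of_nonneg (show 0 ≤ 2 * R ^ 2 by positivity)]
  linarith

lemma memLp_one_add_half_add {μ : Measure Z} [IsFiniteMeasure μ] {g R : Z → ℝ}
    (hg : MemLp g 2 μ) (hR : MemLp R 2 μ) : MemLp (fun z => 1 + (g z / 2 + R z)) 2 μ := by
  have h1 : MemLp (fun z => g z / 2) 2 μ := by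
    simpa only [div_eq_inv_mul] using hg.const_mul (2⁻¹ : ℝ)
  have h2 : MemLp (fun z => g z / 2 + R z) 2 μ := h1.add hR
  have h3 : MemLp (fun _ : Z => (1 : ℝ)) 2 μ := memLp_const 1
  exact h3.add h2

/-- Second order expansion of the mean of a log-likelihood ratio. -/
lemma abs_integral_logRatio_expansion {μ : Measure Z} [IsProbabilityMeasure μ] {g R X : Z → ℝ}
    {a ε : ℝ} (hε : 0 < ε) (hε1 : ε ≤ 1) (ha : 0 ≤ a)
    (hg : MemLp g 2 μ) (hga : ∫ z, g z ^ 2 ∂μ = a ^ 2)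
    (mR : AEStronglyMeasurable R μ) (mX : AEStronglyMeasurable X μ)
    (hX : ∀ᵐ z ∂μ, -1 < g z / 2 + R z ∧ X z = 2 * Real.log (1 + (g z / 2 + R z)))
    (hR : eLpNorm R 2 μ ≤ ENNReal.ofReal (ε * a))
    (hD : eLpNorm (fun z => X z - g z) 2 μ ≤ ENNReal.ofReal (ε * a)) :
    |∫ z, X z ∂μ - ∫ z, ((1 + (g z / 2 + R z)) ^ 2 - 1) ∂μ + a ^ 2 / 2| ≤ 11 * ε * a ^ 2 := by
  have lR : MemLp R 2 μ := ⟨mR, hR.trans_lt ENNReal.ofReal_lt_top⟩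
  have lD : MemLp (fun z => X z - g z) 2 μ := ⟨mX.sub hg.1, hD.trans_lt ENNReal.ofReal_lt_top⟩
  have sq_le : ∀ f : Z → ℝ, MemLp f 2 μ → eLpNorm f 2 μ ≤ ENNReal.ofReal (ε * a) →
      ∫ z, f z ^ 2 ∂μ ≤ (ε * a) ^ 2 := by
    intro f hf hb
    have h1 := (eLpNorm_two_le_ofReal_iff (by positivity)).1 hb
    rw [← ofReal_integral_eq_lintegral_ofReal hf.integrable_sq (ae_of_all _ fun z => sq_nonneg _)]
      at h1
    exact (ENNReal.ofReal_le_ofReal_iff (by positivity)).1 h1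
  have iR := lR.integrable_sq
  have iD := lD.integrable_sq
  have ig := hg.integrable_sq
  have bR := sq_le R lR hR
  have bD := sq_le _ lD hD
  have iX : Integrable X μ := by
    have : Integrable (fun z => (X z - g z) + g z) μ :=
      (lD.integrable one_le_two).add (hg.integrable one_le_two)
    simpa using this
  have iY : Integrable (fun z => (1 + (g z / 2 + R z)) ^ 2 - 1) μ := by
    exact (memLp_one_add_half_add hg lR).integrable_sq.sub (integrable_const _)
  have e : ∫ z, X z ∂μ - ∫ z, ((1 + (g z / 2 + R z)) ^ 2 - 1) ∂μ + a ^ 2 / 2 =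
      ∫ z, (X z - ((1 + (g z / 2 + R z)) ^ 2 - 1) + g z ^ 2 / 2) ∂μ := by
    have i1 : Integrable (fun z => X z - ((1 + (g z / 2 + R z)) ^ 2 - 1)) μ := iX.sub iY
    rw [integral_add i1 (ig.div_const 2), integral_sub iX iY, integral_div, hga]
  rw [e]
  have hb : |∫ z, (X z - ((1 + (g z / 2 + R z)) ^ 2 - 1) + g z ^ 2 / 2) ∂μ| ≤
      ∫ z, ((5 / 4 * ε) * g z ^ 2 + (5 / ε + 2 + ε) * R z ^ 2 + (1 / ε) * (X z - g z) ^ 2) ∂μ := by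
    have i0 : Integrable (fun z => (5 / 4 * ε) * g z ^ 2 + (5 / ε + 2 + ε) * R z ^ 2
        + (1 / ε) * (X z - g z) ^ 2) μ :=
      ((ig.const_mul _).add (iR.const_mul _)).add (iD.const_mul _)
    rw [← Real.norm_eq_abs]
    refine norm_integral_le_of_norm_le i0 ?_
    filter_upwards [hX] with z hz
    refine (abs_sub_add_le_quadratic hε hz.1 hz.2).trans (le_of_eq ?_)
    field_simp
    ring
  refine hb.trans ?_
  have i2 : Integrable (fun z => (5 / 4 * ε) * g z ^ 2 + (5 / ε + 2 + ε) * R z ^ 2) μ :=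
    (ig.const_mul _).add (iR.const_mul _)
  rw [integral_add i2 (iD.const_mul _), integral_add (ig.const_mul _) (iR.const_mul _),
    integral_const_mul, integral_const_mul, integral_const_mul, hga]
  calc _ ≤ 5 / 4 * ε * a ^ 2 + (5 / ε + 2 + ε) * (ε * a) ^ 2 + 1 / ε * (ε * a) ^ 2 := by gcongr
    _ = (5 / 4 * ε + 5 * ε + 2 * ε ^ 2 + ε ^ 3 + ε) * a ^ 2 := by field_simp; ring
    _ ≤ 11 * ε * a ^ 2 := by
      gcongr
      nlinarith [pow_pos hε 2]

lemma isHermitian_fisher (G : ProbabilityMeasure Z) (s : Z → Fin d → ℝ) :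
    (fisher G s).IsHermitian := by
  ext i j
  simp only [fisher, Matrix.conjTranspose_apply, Matrix.of_apply, star_trivial]
  exact integral_congr_ae (ae_of_all _ fun z => mul_comm _ _)

lemma eq_of_dotProduct_mulVec_eq {A B : Matrix (Fin d) (Fin d) ℝ} (hA : A.IsHermitian)
    (hB : B.IsHermitian) (h : ∀ x, x ⬝ᵥ (A *ᵥ x) = x ⬝ᵥ (B *ᵥ x)) : A = B := by
  ext i j
  have key : ∀ C : Matrix (Fin d) (Fin d) ℝ, C.IsHermitian →
      (Pi.single i 1 + Pi.single j 1) ⬝ᵥ (C *ᵥ (Pi.single i 1 + Pi.single j 1)) =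
        Pi.single i 1 ⬝ᵥ (C *ᵥ Pi.single i 1) + Pi.single j 1 ⬝ᵥ (C *ᵥ Pi.single j 1)
          + 2 * C i j := by
    intro C hC
    have hs : C j i = C i j := by simpa using hC.apply i j
    simp only [Matrix.mulVec_add, add_dotProduct, dotProduct_add, Matrix.mulVec_single_one,
      single_one_dotProduct, Matrix.col_apply]
    rw [hs]; ring
  have h1 := key A hA
  have h2 := key B hB
  rw [h, h, h] at h1
  linarith

lemma Model.lintegral_sq_sqrt_ratio (M : Model d Z) {θ₀ θ₁ : Fin d → ℝ} (h0 : θ₀ ∈ M.Θ)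
    (h1 : θ₁ ∈ M.Θ) :
    ∫⁻ z, ENNReal.ofReal ((√(M.p θ₁ z) / √(M.p θ₀ z)) ^ 2) ∂(M.dist θ₀) =
      ∫⁻ z in {z | 0 < M.p θ₀ z}, ENNReal.ofReal (M.p θ₁ z) ∂M.base := by
  have m0 := M.measurable_density h0
  have m1 := M.measurable_density h1
  have m2 : Measurable fun z => ENNReal.ofReal ((√(M.p θ₁ z) / √(M.p θ₀ z)) ^ 2) :=
    ((m1.sqrt.div m0.sqrt).pow_const 2).ennreal_ofReal
  rw [Model.dist, lintegral_withDensity_eq_lintegral_mul _ m0.ennreal_ofReal m2, ← lintegral_indicator (measurableSet_lt measurable_const m0)]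
  refine lintegral_congr fun z => ?_
  rw [Pi.mul_apply, ← ENNReal.ofReal_mul (M.p_nonneg _ h0 z)]
  by_cases hz : 0 < M.p θ₀ z
  · rw [indicator_of_mem (show z ∈ {z | 0 < M.p θ₀ z} from hz), div_pow,
      Real.sq_sqrt hz.le, Real.sq_sqrt (M.p_nonneg _ h1 z)]
    congr 1; field_simp
  · rw [indicator_of_notMem (show z ∉ {z | 0 < M.p θ₀ z} from hz)]
    have : M.p θ₀ z = 0 := le_antisymm (not_lt.1 hz) (M.p_nonneg _ h0 z)
    simp [this]

variable {M : Model d Z} {𝒢 : Set (ProbabilityMeasure Z)}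
  {θ : ProbabilityMeasure Z → Fin d → ℝ} {s : ProbabilityMeasure Z → Z → Fin d → ℝ}
  {V : ProbabilityMeasure Z → Matrix (Fin d) (Fin d) ℝ} {δ : ℕ → ℝ}

lemma Model.Contains.eq_dist {G : ProbabilityMeasure Z} {θ₀ : Fin d → ℝ} (hG : M.Contains G)
    (hθ : M.IsKLProjection G θ₀) : (G : Measure Z) = M.dist θ₀ := by
  obtain ⟨θ', hθ', he⟩ := hG
  have hfin : IsFiniteMeasure (M.dist θ₀) :=
    isFiniteMeasure_withDensity (by rw [M.lintegral_p _ hθ.1]; exact ENNReal.one_ne_top)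
  have h := hθ.2 θ' hθ'
  rw [← he, InformationTheory.klDiv_self] at h
  exact InformationTheory.klDiv_eq_zero_iff.1 (le_antisymm h zero_le)

/-- Comparison of the two quadratic forms along a ray, in terms of the mass that the square of the
root density ratio lacks. -/
lemma exists_radius_form_comparison (hθ : ∀ G ∈ 𝒢, θ G ∈ M.Θ)
    (hδ_pos : ∀ n, 1 ≤ n → 0 < δ n)
    (hA1 : QMD M 𝒢 θ s δ) (hA2 : QuadraticExpansion M 𝒢 θ V δ) (hA4 : MomentConditions M 𝒢 θ s δ)
    (hA5 : UniformLindeberg 𝒢 s) {G : ProbabilityMeasure Z} (hG : G ∈ 𝒢) {h : Fin d → ℝ}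
    (hh : h ≠ 0) {ε : ℝ} (hε : 0 < ε) (hε1 : ε ≤ 1) :
    ∃ t₀ > 0, ∀ t ∈ Ioc 0 t₀, θ G + t • h ∈ M.Θ ∧
      Integrable (fun z => (√(M.p (θ G + t • h) z) / √(M.p (θ G) z)) ^ 2) (G : Measure Z) ∧
      |(∫ z, (√(M.p (θ G + t • h) z) / √(M.p (θ G) z)) ^ 2 ∂(G : Measure Z) - 1)
        + t ^ 2 * (scaledNorm (V G) h ^ 2 - scaledNorm (fisher G (s G)) h ^ 2) / 2| ≤
      t ^ 2 * (ε * (11 * scaledNorm (fisher G (s G)) h ^ 2 + scaledNorm (V G) h ^ 2)) := by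
  obtain ⟨ρ, hρ, happ⟩ := exists_radius_logRatio_approx hθ hδ_pos hA1 hA4 hA5 hε
  obtain ⟨hV, ω, -, hω, hω'⟩ := id hA2
  obtain ⟨n, hn, hn1⟩ := ((hω' ε hε).and (eventually_ge_atTop 1)).exists
  have hI := scaledNorm_fisher_pos hθ hδ_pos hA1 hA2 hA4 hG hh
  have hv := scaledNorm_pos_of_posDef (hV G hG) hh
  set a := scaledNorm (fisher G (s G)) h with ha
  set v := scaledNorm (V G) h with hvd
  have hδn := hδ_pos n hn1
  refine ⟨min (ρ / a) (δ n / v), by positivity, fun t ht => ?_⟩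
  have ht0 : 0 < t := ht.1
  have hta : t * a ≤ ρ := (le_div_iff₀ hI).1 (ht.2.trans (min_le_left _ _))
  have htv : t * v ≤ δ n := (le_div_iff₀ hv).1 (ht.2.trans (min_le_right _ _))
  have eI : scaledNorm (fisher G (s G)) (t • h) = t * a := by
    rw [scaledNorm_smul, abs_of_pos ht0]
  have eV : scaledNorm (V G) (t • h) = t * v := by rw [scaledNorm_smul, abs_of_pos ht0]
  obtain ⟨hmem, hpos, hR, hD⟩ := happ G hG (t • h) (by rw [eI]; positivity) (by rwa [eI])
  have hmean := (hω G hG n hn1 (t * v) ⟨by positivity, htv⟩ (t • h) eV.le hmem).2.2.trans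
    (hn G hG (t * v) ⟨by positivity, htv⟩)
  rw [← scaledNorm_sq_of_posDef (hV G hG), eV] at hmean
  have hs := (hA1.1 G hG).1
  rw [eI] at hR hD
  have mR := M.aestronglyMeasurable_sqrtRemainder (hθ G hG) hmem hs.1
  have mX := (M.measurable_logRatio (hθ G hG) hmem).aestronglyMeasurable (μ := (G : Measure Z))
  have hga : ∫ z, (t • h ⬝ᵥ s G z) ^ 2 ∂(G : Measure Z) = (t * a) ^ 2 := by
    rw [← scaledNorm_fisher_sq hs, eI]
  have hX : ∀ᵐ z ∂(G : Measure Z), -1 < (t • h ⬝ᵥ s G z) / 2 +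
      M.sqrtRemainder (θ G) (t • h) (s G) z ∧ M.logRatio (θ G + t • h) (θ G) z =
      2 * Real.log (1 + ((t • h ⬝ᵥ s G z) / 2 + M.sqrtRemainder (θ G) (t • h) (s G) z)) := by
    filter_upwards [(hA1.1 G hG).2, hpos] with z h0 h1
    exact M.logRatio_eq (s G) h0 h1
  have hg := memLp_dotProduct hs (t • h)
  have hmain := abs_integral_logRatio_expansion hε hε1 (show 0 ≤ t * a by positivity) hg hga mR mX
    hX hR hD
  have eW : ∀ z, 1 + ((t • h ⬝ᵥ s G z) / 2 + M.sqrtRemainder (θ G) (t • h) (s G) z) =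
      √(M.p (θ G + t • h) z) / √(M.p (θ G) z) := fun z => by
    rw [Model.sqrtRemainder]; ring
  have iY : Integrable (fun z => (√(M.p (θ G + t • h) z) / √(M.p (θ G) z)) ^ 2)
      (G : Measure Z) := by
    have hRm : MemLp (M.sqrtRemainder (θ G) (t • h) (s G)) 2 (G : Measure Z) :=
      ⟨mR, hR.trans_lt ENNReal.ofReal_lt_top⟩
    simpa only [eW] using (memLp_one_add_half_add hg hRm).integrable_sq
  refine ⟨hmem, iY, ?_⟩
  simp only [eW] at hmain
  rw [integral_sub iY (integrable_const _), integral_const, probReal_univ, one_smul] at hmain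
  rw [abs_le] at hmain hmean ⊢
  constructor <;> nlinarith

/-- Under correct specification the Hessian dominates the information. -/
lemma scaledNorm_fisher_le_of_contains (hθ : ∀ G ∈ 𝒢, M.IsKLProjection G (θ G))
    (hδ_pos : ∀ n, 1 ≤ n → 0 < δ n)
    (hA1 : QMD M 𝒢 θ s δ) (hA2 : QuadraticExpansion M 𝒢 θ V δ) (hA4 : MomentConditions M 𝒢 θ s δ)
    (hA5 : UniformLindeberg 𝒢 s) {G : ProbabilityMeasure Z} (hG : G ∈ 𝒢) (hc : M.Contains G)
    (h : Fin d → ℝ) :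
    scaledNorm (fisher G (s G)) h ^ 2 ≤ scaledNorm (V G) h ^ 2 := by
  rcases eq_or_ne h 0 with rfl | hh
  · simp [scaledNorm]
  have hθ' : ∀ G ∈ 𝒢, θ G ∈ M.Θ := fun G hG => (hθ G hG).1
  set K := 11 * scaledNorm (fisher G (s G)) h ^ 2 + scaledNorm (V G) h ^ 2 with hK
  have hK0 : 0 ≤ K := by positivity
  refine le_of_forall_pos_le_add fun η hη => ?_
  set ε := min 1 (η / (2 * (K + 1))) with hε
  have hε0 : 0 < ε := lt_min one_pos (by positivity)
  obtain ⟨t, ht0, ht⟩ := exists_radius_form_comparison hθ' hδ_pos hA1 hA2 hA4 hA5 hG hh hε0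
    (min_le_left _ _)
  obtain ⟨hmem, hi, hb⟩ := ht t ⟨ht0, le_rfl⟩
  have hle : ∫ z, (√(M.p (θ G + t • h) z) / √(M.p (θ G) z)) ^ 2 ∂(G : Measure Z) ≤ 1 := by
    have h1 : ENNReal.ofReal (∫ z, (√(M.p (θ G + t • h) z) / √(M.p (θ G) z)) ^ 2
        ∂(G : Measure Z)) ≤ 1 := by
      rw [ofReal_integral_eq_lintegral_ofReal hi (ae_of_all _ fun z => sq_nonneg _)]
      rw [hc.eq_dist (hθ G hG), M.lintegral_sq_sqrt_ratio (hθ' G hG) hmem,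
        ← M.lintegral_p _ hmem]
      exact setLIntegral_le_lintegral _ _
    exact ENNReal.ofReal_le_one.1 h1
  have hεK : ε * K ≤ η / 2 := by
    calc ε * K ≤ η / (2 * (K + 1)) * (K + 1) := by
          gcongr
          · exact min_le_right _ _
          · linarith
      _ = η / 2 := by field_simp
  have h2 := (abs_le.1 hb).1
  have ht2 : 0 < t ^ 2 := by positivity
  have h3 : 0 ≤ t ^ 2 * ((scaledNorm (V G) h ^ 2 - scaledNorm (fisher G (s G)) h ^ 2) / 2
      + ε * K) := by linarith
  have h4 := nonneg_of_mul_nonneg_right h3 ht2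
  linarith

/-- Under correct specification and classical quadratic mean differentiability, the information
matrix identity holds. -/
lemma fisher_eq_of_contains_of_classicalQMDAt (hθ : ∀ G ∈ 𝒢, M.IsKLProjection G (θ G))
    (hδ_pos : ∀ n, 1 ≤ n → 0 < δ n)
    (hA1 : QMD M 𝒢 θ s δ) (hA2 : QuadraticExpansion M 𝒢 θ V δ) (hA4 : MomentConditions M 𝒢 θ s δ)
    (hA5 : UniformLindeberg 𝒢 s) {G : ProbabilityMeasure Z} (hG : G ∈ 𝒢) (hc : M.Contains G)
    (hq : M.ClassicalQMDAt (θ G) (s G)) : fisher G (s G) = V G := by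
  have hθ' : ∀ G ∈ 𝒢, θ G ∈ M.Θ := fun G hG => (hθ G hG).1
  have hs := (hA1.1 G hG).1
  have hV := hA2.1 G hG
  have hform : ∀ h, scaledNorm (fisher G (s G)) h ^ 2 = scaledNorm (V G) h ^ 2 := by
    intro h
    refine le_antisymm
      (scaledNorm_fisher_le_of_contains hθ hδ_pos hA1 hA2 hA4 hA5 hG hc h) ?_
    rcases eq_or_ne h 0 with rfl | hh
    · simp [scaledNorm]
    set K := 11 * scaledNorm (fisher G (s G)) h ^ 2 + scaledNorm (V G) h ^ 2 with hK
    have hK0 : 0 ≤ K := by positivity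
    refine le_of_forall_pos_le_add fun η hη => ?_
    set ε := min 1 (η / (2 * (K + ‖h‖ ^ 2 + 1))) with hε
    have hε0 : 0 < ε := lt_min one_pos (by positivity)
    obtain ⟨t₀, ht₀, ht⟩ := exists_radius_form_comparison hθ' hδ_pos hA1 hA2 hA4 hA5 hG hh hε0
      (min_le_left _ _)
    have htend : Tendsto (fun t : ℝ => t • h) (𝓝[>] 0) (𝓝 0) := by
      have : Continuous fun t : ℝ => t • h := by fun_prop
      simpa using (this.tendsto 0).mono_left nhdsWithin_le_nhds
    obtain ⟨t, hqt, htmem⟩ := ((htend.eventually (hq ε hε0)).and (Ioc_mem_nhdsGT ht₀)).exists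
    obtain ⟨hmem, hi, hb⟩ := ht t htmem
    have ht0 := htmem.1
    set J := ∫ z, (√(M.p (θ G + t • h) z) / √(M.p (θ G) z)) ^ 2 ∂(G : Measure Z) with hJ
    have hJ0 : 0 ≤ J := integral_nonneg fun z => sq_nonneg _
    have mpos : MeasurableSet {z | 0 < M.p (θ G) z} :=
      measurableSet_lt measurable_const (M.measurable_density (hθ' G hG))
    have hge : 1 ≤ J + ε * ‖t • h‖ ^ 2 := by
      have h1 : ENNReal.ofReal J =
          ∫⁻ z in {z | 0 < M.p (θ G) z}, ENNReal.ofReal (M.p (θ G + t • h) z) ∂M.base := by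
        rw [hJ, ofReal_integral_eq_lintegral_ofReal hi (ae_of_all _ fun z => sq_nonneg _)]
        rw [← M.lintegral_sq_sqrt_ratio (hθ' G hG) hmem, ← hc.eq_dist (hθ G hG)]
      have h2 : ∫⁻ z in {z | 0 < M.p (θ G) z}ᶜ, ENNReal.ofReal (M.p (θ G + t • h) z) ∂M.base ≤
          ENNReal.ofReal (ε * ‖t • h‖ ^ 2) := by
        refine le_trans ?_ hqt
        refine le_trans (setLIntegral_mono' mpos.compl fun z hz => ?_)
          (setLIntegral_le_lintegral {z | 0 < M.p (θ G) z}ᶜ _)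
        have : M.p (θ G) z = 0 :=
          le_antisymm (not_lt.1 hz) (M.p_nonneg _ (hθ' G hG) z)
        simp [this, Real.sq_sqrt (M.p_nonneg _ hmem z)]
      have h3 := lintegral_add_compl (μ := M.base)
        (fun z => ENNReal.ofReal (M.p (θ G + t • h) z)) mpos
      rw [M.lintegral_p _ hmem, ← h1] at h3
      have h4 : ENNReal.ofReal 1 ≤ ENNReal.ofReal (J + ε * ‖t • h‖ ^ 2) := by
        rw [ENNReal.ofReal_one, ENNReal.ofReal_add hJ0 (by positivity), ← h3]
        gcongr
      exact (ENNReal.ofReal_le_ofReal_iff (by positivity)).1 h4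
    rw [norm_smul, mul_pow, Real.norm_eq_abs, sq_abs] at hge
    have hεK : ε * (K + ‖h‖ ^ 2) ≤ η / 2 := by
      calc ε * (K + ‖h‖ ^ 2) ≤ η / (2 * (K + ‖h‖ ^ 2 + 1)) * (K + ‖h‖ ^ 2 + 1) :=
            mul_le_mul (min_le_right _ _) (by linarith) (by positivity) (by positivity)
        _ = η / 2 := by field_simp
    have h2 := (abs_le.1 hb).2
    have ht2 : 0 < t ^ 2 := by positivity
    have h3 : 0 ≤ t ^ 2 * (ε * (K + ‖h‖ ^ 2) -
        (scaledNorm (V G) h ^ 2 - scaledNorm (fisher G (s G)) h ^ 2) / 2) := by linarith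
    have h4 := nonneg_of_mul_nonneg_right h3 ht2
    linarith
  refine eq_of_dotProduct_mulVec_eq (isHermitian_fisher _ _) hV.1 fun h => ?_
  rw [← scaledNorm_sq_of_posDef hV, ← hform, scaledNorm_fisher_sq hs, dotProduct_fisher_mulVec hs]

end CorrectSpecification

section SmallestEigenvalue

variable {d : ℕ}

lemma lambdaMin_mul_dotProduct_le {A : Matrix (Fin d) (Fin d) ℝ} (hA : A.IsHermitian)
    (x : Fin d → ℝ) : lambdaMin A * (x ⬝ᵥ x) ≤ x ⬝ᵥ (A *ᵥ x) := by
  have hbdd : BddBelow (spectrum ℝ A) := by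
    rw [hA.spectrum_real_eq_range_eigenvalues]
    exact (Set.finite_range _).bddBelow
  have hherm : (A - algebraMap ℝ _ (lambdaMin A)).IsHermitian := by
    refine hA.sub ?_
    rw [Matrix.algebraMap_eq_diagonal]
    exact Matrix.isHermitian_diagonal _
  have hpsd : (A - algebraMap ℝ _ (lambdaMin A)).PosSemidef := by
    rw [Matrix.posSemidef_iff_isHermitian_and_spectrum_nonneg]
    refine ⟨hherm, fun r hr => ?_⟩
    rw [← spectrum.sub_singleton_eq] at hr
    obtain ⟨y, hy, w, hw, rfl⟩ := hr
    rw [mem_singleton_iff.1 hw]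
    exact sub_nonneg.2 (csInf_le hbdd hy)
  have h := hpsd.dotProduct_mulVec_nonneg x
  rw [star_trivial, Matrix.sub_mulVec, dotProduct_sub, Algebra.algebraMap_eq_smul_one,
    Matrix.smul_mulVec, Matrix.one_mulVec, dotProduct_smul, smul_eq_mul] at h
  linarith

open scoped MatrixOrder in
lemma lambdaMin_sandwich_mul_le {I V : Matrix (Fin d) (Fin d) ℝ} (hI : I.PosDef)
    (hV : V.PosDef) (h : Fin d → ℝ) :
    lambdaMin (sandwich I V) * scaledNorm I h ^ 2 ≤ scaledNorm V h ^ 2 := by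
  set S := CFC.sqrt I with hS
  have hSS : S * S = I := CFC.sqrt_mul_sqrt_self I (Matrix.nonneg_iff_posSemidef.2 hI.posSemidef)
  have hSpsd : S.PosSemidef := Matrix.nonneg_iff_posSemidef.1 (CFC.sqrt_nonneg I)
  have hSt : Sᵀ = S := hSpsd.1
  have hdet : IsUnit S.det := by
    rw [isUnit_iff_ne_zero]
    intro h0
    have := hI.det_pos
    rw [← hSS, Matrix.det_mul, h0, mul_zero] at this
    exact lt_irrefl _ this
  have hherm : (sandwich I V).IsHermitian := by
    have hVt : Vᵀ = V := hV.1
    rw [Matrix.IsHermitian, sandwich, ← hS, Matrix.conjTranspose_eq_transpose_of_trivial]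
    simp only [Matrix.transpose_mul, Matrix.transpose_nonsing_inv, hSt, hVt, Matrix.mul_assoc]
  have key := lambdaMin_mul_dotProduct_le hherm (S *ᵥ h)
  have h1 : (S *ᵥ h) ⬝ᵥ (S *ᵥ h) = h ⬝ᵥ (I *ᵥ h) := by
    rw [Matrix.dotProduct_mulVec, ← Matrix.mulVec_transpose, hSt, Matrix.mulVec_mulVec, hSS,
      dotProduct_comm]
  have h2 : (S *ᵥ h) ⬝ᵥ (sandwich I V *ᵥ (S *ᵥ h)) = h ⬝ᵥ (V *ᵥ h) := by
    have e : sandwich I V *ᵥ (S *ᵥ h) = S⁻¹ *ᵥ (V *ᵥ h) := by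
      rw [sandwich, ← hS, Matrix.mulVec_mulVec, Matrix.mulVec_mulVec, Matrix.mul_assoc,
        Matrix.nonsing_inv_mul _ hdet, Matrix.mul_one]
    rw [e, Matrix.dotProduct_mulVec, ← Matrix.mulVec_transpose, Matrix.transpose_nonsing_inv, hSt,
      Matrix.mulVec_mulVec, Matrix.nonsing_inv_mul _ hdet, Matrix.one_mulVec]
  rw [h1, h2] at key
  rwa [scaledNorm_sq_of_posDef hI, scaledNorm_sq_of_posDef hV]

lemma sqrt_varianceRatio_le (I V : Matrix (Fin d) (Fin d) ℝ) {α : ℝ} (hα : α ∈ Ioo (0 : ℝ) 1)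
    {n : ℕ} (hn : 1 ≤ n) (h : Fin d → ℝ) :
    √(2 * Real.log (1 / α) * varianceRatio I V h) ≤ zQuantile α + rUI I V α n h := by
  have hB : 0 < Real.log (1 / α) := Real.log_pos (by rw [lt_div_iff₀ hα.1]; linarith [hα.2])
  have hsn : 0 < √(n : ℝ) := Real.sqrt_pos.2 (by exact_mod_cast hn)
  simp only [rUI, varianceRatio]
  set B := Real.log (1 / α)
  set v := scaledNorm V h
  rcases (scaledNorm_nonneg I h).eq_or_lt with ha | ha
  · simp [← ha]
  set a := scaledNorm I h
  rw [add_sub_cancel]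
  refine Real.sqrt_le_iff.2 ⟨by positivity, ?_⟩
  have e : (B / (√n * a) + √n * v ^ 2 / (2 * a)) ^ 2 - 2 * B * (v ^ 2 / a ^ 2) =
      (B / (√n * a) - √n * v ^ 2 / (2 * a)) ^ 2 := by
    field_simp; ring
  nlinarith [sq_nonneg (B / (√n * a) - √n * v ^ 2 / (2 * a))]

end SmallestEigenvalue

lemma posDef_fisher {d : ℕ} {Z : Type*} [MeasurableSpace Z] {G : ProbabilityMeasure Z}
    {s : Z → Fin d → ℝ} (h : ∀ x : Fin d → ℝ, x ≠ 0 → 0 < scaledNorm (fisher G s) x) :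
    (fisher G s).PosDef := by
  refine Matrix.PosDef.of_dotProduct_mulVec_pos (isHermitian_fisher G s) fun x hx => ?_
  rw [star_trivial]
  exact Real.sqrt_pos.1 (h x hx)

end UniversalInference

theorem corollary2 {d : ℕ} {Z : Type*} [MeasurableSpace Z]
    -- the working model, the class of data-generating laws, and the target functional
    (M : Model d Z) (𝒢 : Set (ProbabilityMeasure Z))
    (θ : ProbabilityMeasure Z → Fin d → ℝ) (hθ : ∀ G ∈ 𝒢, M.IsKLProjection G (θ G))
    -- scores, Hessians, and the common sequence of radii
    (s : ProbabilityMeasure Z → Z → Fin d → ℝ)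
    (V : ProbabilityMeasure Z → Matrix (Fin d) (Fin d) ℝ)
    (δ : ℕ → ℝ) (hδ_pos : ∀ n, 1 ≤ n → 0 < δ n) (hδ : Tendsto δ atTop (𝓝 0))
    -- the initial estimator, computed from a first subsample of size `k n`
    (k : ℕ → ℕ) (est : (n : ℕ) → (Fin (k n) → Z) → Fin d → ℝ)
    (hest_meas : ∀ n, Measurable (est n)) (hest : ∀ n x, est n x ∈ M.Θ)
    -- the assumptions
    (hA1 : QMD M 𝒢 θ s δ)
    (hA2 : QuadraticExpansion M 𝒢 θ V δ)
    (hA3 : InitialConsistency 𝒢 θ s V δ k est)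
    (hA4 : MomentConditions M 𝒢 θ s δ)
    (hA5 : UniformLindeberg 𝒢 s)
    (α : ℝ) (hα : α ∈ Ioo (0 : ℝ) 1) :
    -- lower bound on the Gaussian coverage proxy
    (∀ G ∈ 𝒢, ∀ n, 1 ≤ n → ∀ x : Fin (k n) → Z, est n x ≠ θ G →
      Φ √(2 * Real.log (1 / α) * varianceRatio (fisher G (s G)) (V G) (est n x - θ G)) ≤
        Φ (zQuantile α + rUI (fisher G (s G)) (V G) α n (est n x - θ G))) ∧
    -- uniform strict conservativeness
    ((zQuantile α : EReal) <
        ⨅ G ∈ 𝒢, ((√(2 * Real.log (1 / α) *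
          lambdaMin (sandwich (fisher G (s G)) (V G))) : ℝ) : EReal) →
      ENNReal.ofReal (1 - α) <
        liminf (fun n => ⨅ G ∈ 𝒢, coverage M θ k est α n G) atTop) ∧
    -- correct specification: the two matrices agree
    (∀ G ∈ 𝒢, M.Contains G → M.ClassicalQMDAt (θ G) (s G) → fisher G (s G) = V G) ∧
    -- correct specification: asymptotic coverage
    ENNReal.ofReal (Φ √(2 * Real.log (1 / α))) ≤
        liminf (fun n => ⨅ G ∈ {G ∈ 𝒢 | M.Contains G}, coverage M θ k est α n G) atTop ∧
    1 - α < Φ √(2 * Real.log (1 / α)) ∧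
    -- correct specification: the method is never exact
    (∀ 𝒞 : Set (ProbabilityMeasure Z), 𝒞.Nonempty → 𝒞 ⊆ {G ∈ 𝒢 | M.Contains G} →
      ¬ UniformlyExact M θ k est α 𝒞) := by
  have hθ' : ∀ G ∈ 𝒢, θ G ∈ M.Θ := fun G hG => (hθ G hG).1
  have hB : 0 < Real.log (1 / α) := Real.log_pos (by rw [lt_div_iff₀ hα.1]; linarith [hα.2])
  have hcov : ∀ (c η : ℝ), 0 < η → ∀ᶠ n in atTop, ∀ G ∈ 𝒢,
      (∀ h, c ^ 2 * scaledNorm (fisher G (s G)) h ^ 2 ≤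
        2 * Real.log (1 / α) * scaledNorm (V G) h ^ 2) →
      ENNReal.ofReal (Φ c - η) ≤ coverage M θ k est α n G := fun c η hη =>
    eventually_forall_coverage_ge hθ' hδ_pos hδ hest_meas hest hA1 hA2 hA3 hA4 hA5 hα hη
  have hsq : √(2 * Real.log (1 / α)) ^ 2 = 2 * Real.log (1 / α) := Real.sq_sqrt (by positivity)
  have hspec : ∀ η : ℝ, 0 < η → ∀ᶠ n in atTop, ∀ G ∈ {G ∈ 𝒢 | M.Contains G},
      ENNReal.ofReal (Φ √(2 * Real.log (1 / α)) - η) ≤ coverage M θ k est α n G := by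
    intro η hη
    filter_upwards [hcov √(2 * Real.log (1 / α)) η hη] with n hn G hG
    refine hn G hG.1 fun h => ?_
    rw [hsq]
    gcongr 2 * Real.log (1 / α) * ?_
    exact scaledNorm_fisher_le_of_contains hθ hδ_pos hA1 hA2 hA4 hA5 hG.1 hG.2 h
  have hgauss : 1 - α < Φ √(2 * Real.log (1 / α)) := by
    have h := one_sub_exp_lt_Φ (Real.sqrt_pos.2 (show 0 < 2 * Real.log (1 / α) by positivity))
    have hexp : Real.exp (-(√(2 * Real.log (1 / α)) ^ 2 / 2)) = α := by
      rw [hsq, mul_div_cancel_left₀ _ (two_ne_zero' ℝ), one_div, Real.log_inv, neg_neg,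
        Real.exp_log hα.1]
    rwa [hexp] at h
  refine ⟨fun G _ n hn x _ => Φ_mono (sqrt_varianceRatio_le _ _ hα hn _), fun hz => ?_,
    fun G hG hc hq => fisher_eq_of_contains_of_classicalQMDAt hθ hδ_pos hA1 hA2 hA4 hA5 hG hc hq,
    ?_, hgauss, fun 𝒞 hne h𝒞 hex => ?_⟩
  · obtain ⟨c₀, hc₀, hc₀'⟩ := EReal.lt_iff_exists_real_btwn.1 hz
    have hΦ : 1 - α < Φ (max c₀ 0) :=
      (exists_lt_of_zQuantile_lt hα (EReal.coe_lt_coe_iff.1 hc₀)).trans_le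
        (Φ_mono (le_max_left _ _))
    set η := (Φ (max c₀ 0) - (1 - α)) / 2 with hη
    have hη0 : 0 < η := by linarith
    refine lt_of_lt_of_le ((ENNReal.ofReal_lt_ofReal_iff (q := Φ (max c₀ 0) - η)
      (by linarith [hα.2])).2 (by linarith)) ?_
    refine le_liminf_of_le (by isBoundedDefault) ?_
    filter_upwards [hcov (max c₀ 0) η hη0] with n hn
    refine le_iInf₂ fun G hG => hn G hG fun h => ?_
    have hI : (fisher G (s G)).PosDef := posDef_fisher fun x hx =>
      scaledNorm_fisher_pos hθ' hδ_pos hA1 hA2 hA4 hG hx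
    have hlam := lambdaMin_sandwich_mul_le hI (hA2.1 G hG) h
    rcases le_or_gt c₀ 0 with h0 | h0
    · rw [max_eq_right h0, zero_pow two_ne_zero, zero_mul]; positivity
    · rw [max_eq_left h0.le]
      have h1 : (c₀ : EReal) < (√(2 * Real.log (1 / α) *
          lambdaMin (sandwich (fisher G (s G)) (V G))) : ℝ) :=
        hc₀'.trans_le (iInf₂_le G hG)
      have h2 := (Real.lt_sqrt h0.le).1 (EReal.coe_lt_coe_iff.1 h1)
      calc c₀ ^ 2 * scaledNorm (fisher G (s G)) h ^ 2 ≤ 2 * Real.log (1 / α) *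
            lambdaMin (sandwich (fisher G (s G)) (V G)) * scaledNorm (fisher G (s G)) h ^ 2 := by
            gcongr
        _ = 2 * Real.log (1 / α) * (lambdaMin (sandwich (fisher G (s G)) (V G)) *
            scaledNorm (fisher G (s G)) h ^ 2) := by ring
        _ ≤ _ := by gcongr
  · refine ENNReal.le_of_forall_pos_le_add fun η hη _ => ?_
    have hη' : (0 : ℝ) < η := by exact_mod_cast hη
    have h1 : ENNReal.ofReal (Φ √(2 * Real.log (1 / α)) - η) ≤
        liminf (fun n => ⨅ G ∈ {G ∈ 𝒢 | M.Contains G}, coverage M θ k est α n G) atTop := by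
      refine le_liminf_of_le (by isBoundedDefault) ?_
      filter_upwards [hspec η hη'] with n hn
      exact le_iInf₂ fun G hG => hn G hG
    calc ENNReal.ofReal (Φ √(2 * Real.log (1 / α)))
        = ENNReal.ofReal (Φ √(2 * Real.log (1 / α)) - η + η) := by rw [sub_add_cancel]
      _ ≤ ENNReal.ofReal (Φ √(2 * Real.log (1 / α)) - η) + ENNReal.ofReal η :=
          ENNReal.ofReal_add_le
      _ ≤ _ := by rw [ENNReal.ofReal_coe_nnreal]; gcongr
  · obtain ⟨G, hG⟩ := hne
    set η := (Φ √(2 * Real.log (1 / α)) - (1 - α)) / 2 with hη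
    have hη0 : 0 < η := by linarith
    have h1 := eventually_lt_of_limsup_lt (lt_of_eq_of_lt hex (ENNReal.ofReal_pos.2 hη0))
    obtain ⟨n, hn1, hn2⟩ := (h1.and (hspec η hη0)).exists
    have h2 := (le_iSup₂_of_le (f := fun G (_ : G ∈ 𝒞) => ENNReal.ofReal
      |(miscoverage M θ k est α n G).toReal - α|) G hG le_rfl).trans_lt hn1
    have h3 := (abs_lt.1 ((ENNReal.ofReal_lt_ofReal_iff hη0).1 h2)).1
    have h4 := hn2 G (h𝒞 hG)
    rw [coverage_toReal_eq hest_meas hest (hθ' G (h𝒞 hG).1)] at h4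
    have h5 : 0 < Φ √(2 * Real.log (1 / α)) - η := by linarith [hα.2]
    have h6 := (ENNReal.ofReal_le_ofReal_iff' (p := Φ √(2 * Real.log (1 / α)) - η)).1 h4
    rcases h6 with h6 | h6 <;> linarith
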